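/- Let $\mathbf{Cat}$ be the category of small categories and functors, $N\colon \mathbf{Cat}\to\mathbf{sSet}$ the nerve functor, and $\mathrm{Ex}\colon\mathbf{sSet}\to\mathbf{sSet}$ Kan's extension functor, i.e. the right adjoint of barycentric subdivision, $\mathrm{Ex}(X)_n=\operatorname{Hom}(\mathrm{Sd}\,\Delta^n,X)$. A functor $f$ between small categories is a *Thomason weak equivalence* if $\mathrm{Ex}^2 N(f)$ is a weak equivalence in the Kan–Quillen model structure on simplicial sets. A model structure on a category with finite products that is cartesian closed is called *cartesian* if it satisfies the pushout product axiom with respect to the cartesian product: for all cofibrations $f\colon A\to B$ and $g\colon X\to Y$, the pushout product $$ (B\times X)\sqcup_{A\times X}(A\times Y)\longrightarrow B\times Y $$ is a cofibration, and it is also a weak equivalence if $f$ or $g$ is a weak equivalence. (No condition on the monoidal unit is imposed.) **Proposition 4.3.** Suppose $\mathbf{Cat}$ is equipped with a model structure whose weak equivalences are exactly the Thomason weak equivalences. Then this model structure is not cartesian. -/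

import Mathlib

open CategoryTheory MonoidalCategory HomotopicalAlgebra

universe u v

namespace ThomasonCat

/-- Simplicial homotopy classes of maps `X ⟶ Z`: the quotient of the set of maps of simplicial sets
by the equivalence relation generated by the existence of a simplicial homotopy `X ⊗ Δ[1] ⟶ Z`.
(When `Z` is a Kan complex, simplicial homotopy is already an equivalence relation.) -/
def HomotopyClasses (X Z : SSet.{u}) : Type u :=
  Quot (fun f g : X ⟶ Z ↦ Nonempty (SSet.Homotopy f g))

/-- Precomposition with `f : X ⟶ Y` on simplicial homotopy classes of maps into `Z`.
It is well defined because a homotopy `Y ⊗ Δ[1] ⟶ Z` can be restricted along `f ▷ Δ[1]`. -/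
def HomotopyClasses.precomp {X Y : SSet.{u}} (f : X ⟶ Y) (Z : SSet.{u}) :
    HomotopyClasses Y Z → HomotopyClasses X Z :=
  Quot.map (fun g ↦ f ≫ g) (fun _ _ ⟨H⟩ ↦
    ⟨SSet.RelativeMorphism.Homotopy.precomp H (SSet.RelativeMorphism.botEquiv.symm f)
      (SSet.Subcomplex.isInitialBot.hom_ext _ _)⟩)

/-- The weak equivalences of the Kan-Quillen model structure on simplicial sets (weak homotopy
equivalences): the maps `f : X ⟶ Y` such that for every Kan complex `Z`,
precomposition with `f` is a bijection `[Y, Z] → [X, Z]` on simplicial homotopy classes. -/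
def kanQuillenWeakEquivalences : MorphismProperty SSet.{u} :=
  fun _ _ f ↦ ∀ (Z : SSet.{u}), SSet.KanComplex Z →
    Function.Bijective (HomotopyClasses.precomp f Z)

/-- The functor `Ex² N : Cat ⥤ sSet`. -/
noncomputable def exSqNerve : Cat.{u, u} ⥤ SSet.{u} :=
  nerveFunctor ⋙ SSet.ex ⋙ SSet.ex

/-- The Thomason weak equivalences: the functors between small categories which `Ex² N` sends
to weak equivalences of the Kan-Quillen model structure. -/
def thomasonWeakEquivalences : MorphismProperty Cat.{u, u} :=
  kanQuillenWeakEquivalences.inverseImage exSqNerve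

/-- A model structure on a closed monoidal category is monoidal if the monoidal product is a left
Quillen bifunctor, i.e. if it satisfies the pushout product axiom. No axiom on the monoidal unit
is required. -/
structure IsMonoidalModelCategory (C : Type u) [Category.{v} C] [MonoidalCategory C]
    [MonoidalClosed C] [ModelCategory C] : Prop where
  /-- the pushout product of two cofibrations is a cofibration -/
  cofibration {A B X Y : C} (f : A ⟶ B) (g : X ⟶ Y) :
    cofibrations C f → cofibrations C g →
      cofibrations C ((Arrow.pushoutProduct.obj (.mk f)).obj (.mk g)).hom
  /-- the pushout product of an acyclic cofibration and a cofibration is acyclic -/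
  acyclic_left {A B X Y : C} (f : A ⟶ B) (g : X ⟶ Y) :
    trivialCofibrations C f → cofibrations C g →
      trivialCofibrations C ((Arrow.pushoutProduct.obj (.mk f)).obj (.mk g)).hom
  /-- the pushout product of a cofibration and an acyclic cofibration is acyclic -/
  acyclic_right {A B X Y : C} (f : A ⟶ B) (g : X ⟶ Y) :
    cofibrations C f → trivialCofibrations C g →
      trivialCofibrations C ((Arrow.pushoutProduct.obj (.mk f)).obj (.mk g)).hom

/-- A model structure on a cartesian closed category is cartesian if it is monoidal with respect
to the cartesian product. -/
def IsCartesianModelCategory (C : Type u) [Category.{v} C] [CartesianMonoidalCategory C]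
    [MonoidalClosed C] [ModelCategory C] : Prop :=
  IsMonoidalModelCategory C

end ThomasonCat

/-! Suppose the structure is cartesian and let `i : 𝟙_ ⟶ J` be a trivial cofibration with image `o`.
The pushout product `J × 1 ∪ 1 × J ⟶ J × J` of `i` with itself is a trivial cofibration. Hence
functors `p q : J ⥤ V` with `p o = q o` become, after a Thomason equivalence `P : V ⥤ V'`, the
restrictions of one functor on `J × J` to `J × {o}` and `{o} × J`. For `f : o ⟶ x`, the two paths
from `(o, o)` to `(x, x)` then embed `P (p f)` and `P (q f)` in a commutative square.

The class `H²(-; ℤ/2)` sees this constraint. If `s t : v ⟶ p o` have equal composites with `p f`,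
and also with `q f`, the four triangles so obtained form a 2-sphere in the nerve of `V`. Every
cocycle on `V` sums to zero over it, because the sphere bounds in `V'` (`HasVanishingSums`). If `f`
were not a split mono, `Collage o` would contain such a sphere with sum 1. So morphisms out of `o`
are split monos and, dually, morphisms into `o` are split epis. Receiving a morphism from `o` is
then invariant along morphisms; as `J` is connected, every object receives one, and its retraction
leads back to `o` (`hom_nonempty`).

Now factor `{0} ⟶ [1]` as such an `i` followed by a fibration. The latter is a trivial fibration,
hence surjective on objects, and an object over 1 has a morphism to `o` over 0: absurd.

Only low-dimensional invariants of `Ex² N` are needed. Cocycles and locally constant functions on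
`X` extend to `Ex² X` by explicit formulas, and they are represented by the Kan complexes
`eilenbergMacLane` and `constBool`. -/

namespace ThomasonCat

section SimplicialSets

open Simplicial Opposite SSet

/-! ### Mod 2 cocycles and the Kan complex that represents them -/

/-- A normalized 2-cocycle modulo 2 on a simplicial set. -/
structure IsCocycle {X : SSet.{u}} (c : X _⦋2⦌ → ZMod 2) : Prop where
  σ (i : Fin 2) (e : X _⦋1⦌) : c (X.σ i e) = 0
  δ (x : X _⦋3⦌) : c (X.δ 0 x) + c (X.δ 1 x) + c (X.δ 2 x) + c (X.δ 3 x) = 0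

/-- Two 2-cochains are cohomologous if their difference is a coboundary. -/
def Cohomologous {X : SSet.{u}} (c d : X _⦋2⦌ → ZMod 2) : Prop :=
  ∃ b : X _⦋1⦌ → ZMod 2, ∀ s, c s + d s = b (X.δ 0 s) + b (X.δ 1 s) + b (X.δ 2 s)

namespace IsCocycle

variable {X Y : SSet.{u}}

lemma comp {c : Y _⦋2⦌ → ZMod 2} (hc : IsCocycle c) (f : X ⟶ Y) :
    IsCocycle (fun s ↦ c (f.app (op ⦋2⦌) s)) where
  σ i e := by rw [SSet.σ_naturality_apply]; exact hc.σ _ _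
  δ x := by simp only [SSet.δ_naturality_apply]; exact hc.δ _

end IsCocycle

/-- The Eilenberg-MacLane simplicial set `K(ℤ/2, 2)`, whose simplices are the cocycles
on the standard simplices. -/
def eilenbergMacLane : SSet.{u} where
  obj n := { c : (SSet.stdSimplex.{u}.obj n.unop) _⦋2⦌ → ZMod 2 // IsCocycle c }
  map f := ↾fun c ↦ ⟨_, c.2.comp (SSet.stdSimplex.map f.unop)⟩
  map_id n := by
    ext c t
    refine congr_arg c.1 ?_
    exact ConcreteCategory.congr_hom (congr_app (SSet.stdSimplex.map_id n.unop) _) t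
  map_comp f g := by
    ext c t
    refine congr_arg c.1 ?_
    exact ConcreteCategory.congr_hom (congr_app (SSet.stdSimplex.map_comp g.unop f.unop) _) t

/-- The cocycle corresponding to a map to `K(ℤ/2, 2)`. -/
def cocycleOf {X : SSet.{u}} (φ : X ⟶ eilenbergMacLane) (s : X _⦋2⦌) : ZMod 2 :=
  (φ.app _ s).1 (yonedaEquiv (𝟙 _))

lemma cocycleOf_comp {X Y : SSet.{u}} (f : X ⟶ Y) (φ : Y ⟶ eilenbergMacLane) (s : X _⦋2⦌) :
    cocycleOf (f ≫ φ) s = cocycleOf φ (f.app _ s) := rfl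

lemma apply_eq_cocycleOf {X : SSet.{u}} (φ : X ⟶ eilenbergMacLane) {n : ℕ} (x : X _⦋n⦌)
    (t : Δ[n] _⦋2⦌) :
    (φ.app _ x).1 t = cocycleOf φ ((yonedaEquiv.symm x).app _ t) := by
  obtain ⟨t, rfl⟩ := stdSimplex.objEquiv.symm.surjective t
  rw [cocycleOf, yonedaEquiv_symm_app_objEquiv_symm, NatTrans.naturality_apply]
  refine congr_arg (φ.app _ x).1 ?_
  change _ = (SSet.stdSimplex.map t).app _ (stdSimplex.objEquiv.symm (𝟙 _))
  rw [← stdSimplex.objEquiv_symm_comp, Category.id_comp]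

lemma isCocycle_cocycleOf {X : SSet.{u}} (φ : X ⟶ eilenbergMacLane) :
    IsCocycle (cocycleOf φ) where
  σ i e := by
    have := (φ.app _ e).2.σ i (yonedaEquiv (𝟙 _))
    rw [apply_eq_cocycleOf] at this
    convert this using 2
    rw [SSet.σ_naturality_apply]
    simp
  δ x := by
    have := (φ.app _ x).2.δ (yonedaEquiv (𝟙 _))
    simp only [apply_eq_cocycleOf, SSet.δ_naturality_apply] at this
    simpa using this

/-- The map to `K(ℤ/2, 2)` corresponding to a cocycle. -/
def classifyingMap {X : SSet.{u}} {c : X _⦋2⦌ → ZMod 2} (hc : IsCocycle c) :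
    X ⟶ eilenbergMacLane where
  app n := ↾fun x ↦ ⟨_, hc.comp (yonedaEquiv.symm x)⟩
  naturality n m f := by
    ext x
    apply Subtype.ext
    funext t
    change c _ = c _
    congr 1
    exact (ConcreteCategory.congr_hom
      (congr_app (yonedaEquiv_symm_naturality_left f.unop x) _) t).symm

lemma cocycleOf_classifyingMap {X : SSet.{u}} {c : X _⦋2⦌ → ZMod 2} (hc : IsCocycle c) :
    cocycleOf (classifyingMap hc) = c := by
  funext s
  change c _ = c _
  simp

lemma eilenbergMacLane_hom_ext {X : SSet.{u}} {φ ψ : X ⟶ eilenbergMacLane}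
    (h : cocycleOf φ = cocycleOf ψ) : φ = ψ := by
  ext ⟨n⟩ x
  induction n using SimplexCategory.rec with | _ n
  apply Subtype.ext
  funext t
  exact (apply_eq_cocycleOf φ x t).trans ((congr_fun h _).trans (apply_eq_cocycleOf ψ x t).symm)

lemma kanComplex_of_horn_filling {Z : SSet.{u}}
    (h : ∀ (n : ℕ) (i : Fin (n + 2)) (φ : (Λ[n + 1, i] : SSet) ⟶ Z),
      ∃ ψ : Δ[n + 1] ⟶ Z, Λ[n + 1, i].ι ≫ ψ = φ) : KanComplex Z := by
  rw [KanComplex.iff]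
  intro n i f hf
  obtain ⟨ψ, hψ⟩ := h n i hf.desc
  refine ⟨ψ, fun j hj ↦ ?_⟩
  rw [← hf.ι_desc j hj, ← hψ, horn.ι_ι_assoc]

section Horn

variable {n : ℕ} {i : Fin (n + 1)}

open Classical in
/-- A 2-cochain on a horn, as a function of the vertices, extended by zero. -/
noncomputable def hornCochain (c : (Λ[n, i] : SSet.{u}) _⦋2⦌ → ZMod 2) (x y z : Fin (n + 1)) :
    ZMod 2 :=
  if h : ∃ (h₁ : x ≤ y) (h₂ : y ≤ z),
      stdSimplex.triangle.{u} x y z h₁ h₂ ∈ (Λ[n, i]).obj (op ⦋2⦌) then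
    c ⟨_, h.choose_spec.choose_spec⟩
  else 0

variable {c : (Λ[n, i] : SSet.{u}) _⦋2⦌ → ZMod 2}

lemma hornCochain_eq (s : (Λ[n, i] : SSet.{u}) _⦋2⦌) :
    hornCochain c (s.1 0) (s.1 1) (s.1 2) = c s := by
  have h : stdSimplex.triangle.{u} (s.1 0) (s.1 1) (s.1 2)
      (stdSimplex.monotone_apply s.1 (by simp)) (stdSimplex.monotone_apply s.1 (by decide)) =
        s.1 := by
    ext k : 1
    fin_cases k <;> rfl
  rw [hornCochain, dif_pos ⟨_, _, by rw [h]; exact s.2⟩]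
  exact congr_arg c (Subtype.ext h)

lemma hornCochain_of_not_mem {x y z : Fin (n + 1)}
    (h : ∀ s : (Λ[n, i] : SSet.{u}) _⦋2⦌, ¬ (s.1 0 = x ∧ s.1 1 = y ∧ s.1 2 = z)) :
    hornCochain c x y z = 0 :=
  dif_neg (fun ⟨_, _, hs⟩ ↦ h ⟨_, hs⟩ ⟨rfl, rfl, rfl⟩)

lemma IsCocycle.hornCochain_left (hc : IsCocycle c) (x y : Fin (n + 1)) :
    hornCochain c x x y = 0 := by
  by_cases h : ∃ s : (Λ[n, i] : SSet.{u}) _⦋2⦌, s.1 0 = x ∧ s.1 1 = x ∧ s.1 2 = y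
  · obtain ⟨s, hx, hx', hy⟩ := h
    have hs : s = (Λ[n, i] : SSet.{u}).σ 0 ((Λ[n, i] : SSet.{u}).δ 0 s) := by
      apply Subtype.ext
      ext k : 1
      change s.1 k = s.1 ((0 : Fin 3).succAbove ((0 : Fin 2).predAbove k))
      fin_cases k
      · exact hx.trans hx'.symm
      · rfl
      · rfl
    have := hc.σ 0 ((Λ[n, i] : SSet.{u}).δ 0 s)
    rwa [← hs, ← hornCochain_eq (c := c), hx, hx', hy] at this
  · push Not at h
    exact hornCochain_of_not_mem (by grind)

lemma IsCocycle.hornCochain_right (hc : IsCocycle c) (x y : Fin (n + 1)) :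
    hornCochain c x y y = 0 := by
  by_cases h : ∃ s : (Λ[n, i] : SSet.{u}) _⦋2⦌, s.1 0 = x ∧ s.1 1 = y ∧ s.1 2 = y
  · obtain ⟨s, hx, hy, hy'⟩ := h
    have hs : s = (Λ[n, i] : SSet.{u}).σ 1 ((Λ[n, i] : SSet.{u}).δ 1 s) := by
      apply Subtype.ext
      ext k : 1
      change s.1 k = s.1 ((1 : Fin 3).succAbove ((1 : Fin 2).predAbove k))
      fin_cases k
      · rfl
      · exact hy.trans hy'.symm
      · rfl
    have := hc.σ 1 ((Λ[n, i] : SSet.{u}).δ 1 s)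
    rwa [← hs, ← hornCochain_eq (c := c), hx, hy, hy'] at this
  · push Not at h
    exact hornCochain_of_not_mem (by grind)

lemma IsCocycle.hornCochain_tetrahedron (hc : IsCocycle c) {x y z w : Fin (n + 1)} (hxy : x ≤ y)
    (hyz : y ≤ z) (hzw : z ≤ w) (h : ∃ j ≠ i, j ≠ x ∧ j ≠ y ∧ j ≠ z ∧ j ≠ w) :
    hornCochain c y z w + hornCochain c x z w + hornCochain c x y w + hornCochain c x y z = 0 := by
  let t : Δ[n] _⦋3⦌ := stdSimplex.objMk ⟨![x, y, z, w], by
    rw [Fin.monotone_iff_le_succ]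
    intro k
    fin_cases k <;> assumption⟩
  have ht : t ∈ (Λ[n, i]).obj (op ⦋3⦌) := by
    rw [mem_horn_iff_notMem_range]
    obtain ⟨j, hj, h⟩ := h
    refine ⟨j, hj, ?_⟩
    rintro ⟨k, hk⟩
    fin_cases k
    · exact h.1 hk.symm
    · exact h.2.1 hk.symm
    · exact h.2.2.1 hk.symm
    · exact h.2.2.2 hk.symm
  have := hc.δ ⟨t, ht⟩
  simp only [← hornCochain_eq (c := c)] at this
  exact this

/-- The cone with apex `i` on a 2-cochain on a horn with missing face opposite to `i`. -/
noncomputable def hornCone (c : (Λ[n, i] : SSet.{u}) _⦋2⦌ → ZMod 2) (x y : Fin (n + 1)) : ZMod 2 :=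
  if y ≤ i then hornCochain c x y i else
    if x ≤ i then hornCochain c x i y else hornCochain c i x y

lemma IsCocycle.hornCone_self (hc : IsCocycle c) (x : Fin (n + 1)) : hornCone c x x = 0 := by
  simp only [hornCone, hc.hornCochain_left, hc.hornCochain_right]
  split_ifs <;> rfl

/-- This is the cocycle relation on the tetrahedron with vertices `x, y, z, i`, in one of four
orders. The face opposite to `j` contains `i`, so the tetrahedron stays in the horn. -/
lemma IsCocycle.coboundary_hornCone (hc : IsCocycle c) {x y z : Fin (n + 1)} (hxy : x ≤ y)
    (hyz : y ≤ z) (h : ∃ j ≠ i, j ≠ x ∧ j ≠ y ∧ j ≠ z) :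
    hornCone c y z + hornCone c x z + hornCone c x y = hornCochain c x y z := by
  obtain ⟨j, hj, h⟩ := h
  simp only [hornCone]
  rcases le_total z i with hz | hz
  · have := hc.hornCochain_tetrahedron hxy hyz hz ⟨j, by grind⟩
    grind
  rcases le_total y i with hy | hy
  · have := hc.hornCochain_tetrahedron hxy hy hz ⟨j, by grind⟩
    have := hc.hornCochain_left
    have := hc.hornCochain_right
    grind
  rcases le_total x i with hx | hx
  · have := hc.hornCochain_tetrahedron hx hy hyz ⟨j, by grind⟩
    have := hc.hornCochain_left
    have := hc.hornCochain_right
    grind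
  · have := hc.hornCochain_tetrahedron hx hxy hyz ⟨j, by grind⟩
    have := hc.hornCochain_left
    have := hc.hornCochain_right
    grind

lemma isCocycle_coboundary {b : Fin (n + 1) → Fin (n + 1) → ZMod 2} (hb : ∀ x, b x x = 0) :
    IsCocycle (X := Δ[n]) (fun t : Δ[n] _⦋2⦌ ↦ b (t 1) (t 2) + b (t 0) (t 2) + b (t 0) (t 1)) where
  σ k e := by
    fin_cases k
    · change b (e 0) (e 1) + b (e 0) (e 1) + b (e 0) (e 0) = 0
      grind
    · change b (e 1) (e 1) + b (e 0) (e 1) + b (e 0) (e 1) = 0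
      grind
  δ t := by
    change (b (t 2) (t 3) + b (t 1) (t 3) + b (t 1) (t 2)) +
      (b (t 2) (t 3) + b (t 0) (t 3) + b (t 0) (t 2)) +
      (b (t 1) (t 3) + b (t 0) (t 3) + b (t 0) (t 1)) +
      (b (t 1) (t 2) + b (t 0) (t 2) + b (t 0) (t 1)) = 0
    grind

end Horn

instance : KanComplex eilenbergMacLane.{u} := by
  refine kanComplex_of_horn_filling fun n i φ ↦ ?_
  have hc := isCocycle_cocycleOf φ
  -- `hornCone` is defined on all edges of the simplex, with default value zero, so its coboundary
  -- is a cocycle on the whole simplex.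
  refine ⟨classifyingMap (isCocycle_coboundary (b := hornCone (cocycleOf φ)) hc.hornCone_self),
    eilenbergMacLane_hom_ext (funext fun s ↦ ?_)⟩
  rw [cocycleOf_comp, cocycleOf_classifyingMap, ← hornCochain_eq (c := cocycleOf φ)]
  obtain ⟨j, hj, h⟩ := (mem_horn_iff_notMem_range _ _).1 s.2
  exact hc.coboundary_hornCone (stdSimplex.monotone_apply s.1 (by simp))
    (stdSimplex.monotone_apply s.1 (by decide))
    ⟨j, hj, fun e ↦ h ⟨_, e.symm⟩, fun e ↦ h ⟨_, e.symm⟩, fun e ↦ h ⟨_, e.symm⟩⟩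

/-- The prism over `s` is cut into the tetrahedra `K.h 0 s`, `K.h 1 s`, `K.h 2 s`. Adding their
cocycle relations cancels the inner walls; the ends give the two cocycles and the sides give the
coboundary. -/
lemma IsCocycle.cohomologous {X Y : SSet.{u}} {f g : X ⟶ Y} (K : SimplicialObject.Homotopy f g)
    {c : Y _⦋2⦌ → ZMod 2} (hc : IsCocycle c) :
    Cohomologous (fun s ↦ c (f.app (op ⦋2⦌) s)) (fun s ↦ c (g.app (op ⦋2⦌) s)) := by
  refine ⟨fun e ↦ c (K.h 0 e) + c (K.h 1 e), fun s ↦ ?_⟩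
  have h0 := hc.δ (K.h 0 s)
  have h1 := hc.δ (K.h 1 s)
  have h2 := hc.δ (K.h 2 s)
  have e1 : Y.δ 0 (K.h 0 s) = g.app _ s :=
    ConcreteCategory.congr_hom (K.h_zero_comp_δ_zero 2) s
  have e2 : Y.δ 3 (K.h 2 s) = f.app _ s :=
    ConcreteCategory.congr_hom (K.h_last_comp_δ_last 2) s
  have e3 : Y.δ 0 (K.h 1 s) = K.h 0 (X.δ 0 s) :=
    ConcreteCategory.congr_hom (K.h_succ_comp_δ_castSucc_of_lt (n := 1) 0 0 (by decide)) s
  have e4 : Y.δ 0 (K.h 2 s) = K.h 1 (X.δ 0 s) :=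
    ConcreteCategory.congr_hom (K.h_succ_comp_δ_castSucc_of_lt (n := 1) 0 1 (by decide)) s
  have e5 : Y.δ 1 (K.h 2 s) = K.h 1 (X.δ 1 s) :=
    ConcreteCategory.congr_hom (K.h_succ_comp_δ_castSucc_of_lt (n := 1) 1 1 (by decide)) s
  have e6 : Y.δ 1 (K.h 1 s) = Y.δ 1 (K.h 0 s) :=
    ConcreteCategory.congr_hom (K.h_succ_comp_δ_castSucc_succ (n := 1) 0) s
  have e7 : Y.δ 2 (K.h 2 s) = Y.δ 2 (K.h 1 s) :=
    ConcreteCategory.congr_hom (K.h_succ_comp_δ_castSucc_succ (n := 1) 1) s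
  have e8 : Y.δ 2 (K.h 0 s) = K.h 0 (X.δ 1 s) :=
    ConcreteCategory.congr_hom (K.h_castSucc_comp_δ_succ_of_lt (n := 1) 1 0 (by decide)) s
  have e9 : Y.δ 3 (K.h 0 s) = K.h 0 (X.δ 2 s) :=
    ConcreteCategory.congr_hom (K.h_castSucc_comp_δ_succ_of_lt (n := 1) 2 0 (by decide)) s
  have e10 : Y.δ 3 (K.h 1 s) = K.h 1 (X.δ 2 s) :=
    ConcreteCategory.congr_hom (K.h_castSucc_comp_δ_succ_of_lt (n := 1) 2 1 (by decide)) s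
  rw [e1, e8, e9] at h0
  rw [e3, e6, e10] at h1
  rw [e4, e5, e7, e2] at h2
  grind

/-- A simplicial homotopy between maps to `K(ℤ/2, 2)` yields cohomologous cocycles. -/
lemma cohomologous_of_homotopy {X : SSet.{u}} {f g : X ⟶ eilenbergMacLane.{u}}
    (H : SSet.Homotopy f g) : Cohomologous (cocycleOf f) (cocycleOf g) :=
  (isCocycle_cocycleOf (𝟙 _)).cohomologous H.toSimplicialObjectHomotopy

/-! ### Maps to a two-element set, which detect connected components -/

/-- The constant simplicial set with two elements. -/
abbrev constBool : SSet.{u} := (Functor.const _).obj (ULift.{u} Bool)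

lemma constBool_app_map {X : SSet.{u}} (φ : X ⟶ constBool) {n m : SimplexCategoryᵒᵖ} (f : n ⟶ m)
    (x : X.obj n) : φ.app m (X.map f x) = φ.app n x :=
  NatTrans.naturality_apply φ f x

instance : KanComplex constBool.{u} := by
  refine kanComplex_of_horn_filling fun n i φ ↦ ?_
  let v (x : Fin (n + 2)) : Δ[n + 1] _⦋0⦌ := stdSimplex.const (n + 1) x (op ⦋0⦌)
  have hi : v i ∈ (Λ[n + 1, i]).obj (op ⦋0⦌) := by
    rw [mem_horn_iff_notMem_range]
    obtain ⟨j, hj⟩ := exists_ne i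
    exact ⟨j, hj, fun ⟨k, hk⟩ ↦ hj hk.symm⟩
  have hv {m : ℕ} (s : (Λ[n + 1, i] : SSet.{u}) _⦋m⦌) (k : Fin (m + 1))
      (h : v (s.1 k) ∈ (Λ[n + 1, i]).obj (op ⦋0⦌)) :
      φ.app (op ⦋0⦌) ⟨v (s.1 k), h⟩ = φ.app _ s := by
    rw [← constBool_app_map φ (SimplexCategory.const ⦋0⦌ ⦋m⦌ k).op s]
    refine congr_arg (φ.app (op ⦋0⦌)) (Subtype.ext ?_)
    ext l
    rfl
  refine ⟨{ app m := ↾fun _ ↦ φ.app (op ⦋0⦌) ⟨v i, hi⟩ }, ?_⟩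
  ext ⟨m⟩ ⟨s, hs⟩
  induction m using SimplexCategory.rec with | _ m
  have hs' := hs
  rw [mem_horn_iff_notMem_range] at hs
  obtain ⟨j, hj, hs⟩ := hs
  have hj' (x : Fin (n + 2)) (hx : x ≠ j) : v x ∈ (Λ[n + 1, i]).obj (op ⦋0⦌) := by
    rw [mem_horn_iff_notMem_range]
    exact ⟨j, hj, fun ⟨k, hk⟩ ↦ hx hk⟩
  -- A simplex of the horn misses some `j ≠ i`, and so does the edge joining its initial vertex to
  -- `i`. That edge is in the horn, so `φ` takes everywhere its value at `i`.
  have he (x y : Fin (n + 2)) (hxy : x ≤ y) (hx : x ≠ j) (hy : y ≠ j) :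
      φ.app (op ⦋0⦌) ⟨v x, hj' x hx⟩ = φ.app (op ⦋0⦌) ⟨v y, hj' y hy⟩ := by
    have h : stdSimplex.edge.{u} (n + 1) x y hxy ∈ (Λ[n + 1, i]).obj (op ⦋1⦌) := by
      rw [mem_horn_iff_notMem_range]
      refine ⟨j, hj, ?_⟩
      rintro ⟨k, hk⟩
      fin_cases k
      · exact hx hk
      · exact hy hk
    exact (hv ⟨_, h⟩ 0 (hj' x hx)).trans (hv ⟨_, h⟩ 1 (hj' y hy)).symm
  have h0 : s 0 ≠ j := fun h ↦ hs ⟨0, h⟩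
  refine Eq.trans ?_ (hv ⟨s, hs'⟩ 0 (hj' _ h0))
  rcases le_total (s 0) i with h | h
  · exact (he _ _ h h0 hj.symm).symm
  · exact he _ _ h hj.symm h0

lemma eq_of_simplicialHomotopy_constBool {X : SSet.{u}} {f g : X ⟶ constBool.{u}}
    (K : SimplicialObject.Homotopy f g) : f = g := by
  have h (x : X _⦋0⦌) : f.app _ x = g.app _ x :=
    (ConcreteCategory.congr_hom (K.h_last_comp_δ_last 0) x).symm.trans
      (ConcreteCategory.congr_hom (K.h_zero_comp_δ_zero 0) x)
  ext n x
  let v : n ⟶ op ⦋0⦌ := (SimplexCategory.const ⦋0⦌ n.unop 0).op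
  exact (constBool_app_map f v x).symm.trans ((h (X.map v x)).trans (constBool_app_map g v x))

lemma eq_of_homotopy_constBool {X : SSet.{u}} {f g : X ⟶ constBool.{u}} (H : SSet.Homotopy f g) :
    f = g :=
  eq_of_simplicialHomotopy_constBool H.toSimplicialObjectHomotopy

/-! ### Barycentric subdivision and extension of cocycles to `Ex X` -/

open PartialOrder

section NerveCochain

variable {P : Type u} [PartialOrder P]

/-- The triangle in the nerve of a partially ordered type attached to a chain `a ≤ b ≤ c`. -/
def nerveTriangle {a b c : P} (hab : a ≤ b) (hbc : b ≤ c) : (nerve P) _⦋2⦌ :=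
  Monotone.functor (f := ![a, b, c]) (by
    rw [Fin.monotone_iff_le_succ]
    intro k
    fin_cases k <;> assumption)

open Classical in
/-- A 2-cochain on the nerve of a partially ordered type as a function of vertices,
extended by zero. -/
noncomputable def nerveCochain (g : (nerve P) _⦋2⦌ → ZMod 2) (a b c : P) : ZMod 2 :=
  if h : a ≤ b ∧ b ≤ c then g (nerveTriangle h.1 h.2) else 0

lemma nerveCochain_eq (g : (nerve P) _⦋2⦌ → ZMod 2) {a b c : P} (hab : a ≤ b) (hbc : b ≤ c) :
    nerveCochain g a b c = g (nerveTriangle hab hbc) :=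
  dif_pos ⟨hab, hbc⟩

lemma IsCocycle.nerveCochain_tetrahedron {g : (nerve P) _⦋2⦌ → ZMod 2} (hg : IsCocycle g)
    {a b c d : P} (hab : a ≤ b) (hbc : b ≤ c) (hcd : c ≤ d) :
    nerveCochain g b c d + nerveCochain g a c d + nerveCochain g a b d +
      nerveCochain g a b c = 0 := by
  let t : (nerve P) _⦋3⦌ := Monotone.functor (f := ![a, b, c, d]) (by
    rw [Fin.monotone_iff_le_succ]
    intro k
    fin_cases k <;> assumption)
  have h := hg.δ t
  have h0 : (nerve P).δ 0 t = nerveTriangle hbc hcd :=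
    nerve.ext_of_isThin (by funext k; fin_cases k <;> rfl)
  have h1 : (nerve P).δ 1 t = nerveTriangle (hab.trans hbc) hcd :=
    nerve.ext_of_isThin (by funext k; fin_cases k <;> rfl)
  have h2 : (nerve P).δ 2 t = nerveTriangle hab (hbc.trans hcd) :=
    nerve.ext_of_isThin (by funext k; fin_cases k <;> rfl)
  have h3 : (nerve P).δ 3 t = nerveTriangle hab hbc :=
    nerve.ext_of_isThin (by funext k; fin_cases k <;> rfl)
  rw [h0, h1, h2, h3] at h
  rwa [nerveCochain_eq g hbc hcd, nerveCochain_eq g (hab.trans hbc) hcd,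
    nerveCochain_eq g hab (hbc.trans hcd), nerveCochain_eq g hab hbc]

end NerveCochain

section Subdivision

variable {n : ℕ}

/-- The partially ordered type of nonempty subsets of `Fin (n + 1)`, whose nerve is
the subdivision of `Δ[n]`. -/
abbrev Faces (n : ℕ) : Type u := NonemptyFiniteChains (ULift.{u} (Fin (n + 1)))

/-- The face with given vertices. -/
def faceOfList (x : Fin (n + 1)) (l : List (Fin (n + 1))) : Faces.{u} n where
  finset := ((x :: l).map ULift.up).toFinset
  nonempty := by simp
  comparable _ _ := le_total _ _

/-- The maximal face. -/
def topFace (n : ℕ) : Faces.{u} n where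
  finset := Finset.univ
  nonempty := Finset.univ_nonempty
  comparable _ _ := le_total _ _

lemma le_topFace (a : Faces.{u} n) : a ≤ topFace n := Finset.subset_univ _

lemma faceOfList_le {x y : Fin (n + 1)} {l l' : List (Fin (n + 1))} (h : x :: l ⊆ y :: l') :
    faceOfList.{u} x l ≤ faceOfList y l' := by
  intro a
  simp only [faceOfList, List.mem_toFinset, List.mem_map]
  rintro ⟨b, hb, rfl⟩
  exact ⟨b, h hb, rfl⟩

lemma faceOfList_congr {x y : Fin (n + 1)} {l l' : List (Fin (n + 1))} (h : x :: l ⊆ y :: l')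
    (h' : y :: l' ⊆ x :: l) : faceOfList.{u} x l = faceOfList y l' :=
  le_antisymm (faceOfList_le h) (faceOfList_le h')

/-- The 2-simplex of the subdivision of `Δ[n]` given by a flag. -/
def flag (x y z : Fin (n + 1)) : (SimplexCategory.sd.{u}.obj ⦋n⦌) _⦋2⦌ :=
  nerveTriangle (P := Faces n) (a := faceOfList x []) (b := faceOfList x [y])
    (c := faceOfList x [y, z]) (faceOfList_le (by simp)) (faceOfList_le (by simp))

lemma map_faceOfList {m : ℕ} (f : (ULift.{u} (Fin (n + 1))) →o ULift.{u} (Fin (m + 1)))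
    (x : Fin (n + 1)) (l : List (Fin (n + 1))) :
    (faceOfList x l).map f = faceOfList (f ⟨x⟩).down (l.map (fun y ↦ (f ⟨y⟩).down)) := by
  ext a
  simp [faceOfList]
  aesop

lemma sd_map_flag {m : ℕ} (f : (⦋n⦌ : SimplexCategory) ⟶ ⦋m⦌) (x y z : Fin (n + 1)) :
    (SimplexCategory.sd.{u}.map f).app (op ⦋2⦌) (flag x y z) =
      flag (f.toOrderHom x) (f.toOrderHom y) (f.toOrderHom z) := by
  refine nerve.ext_of_isThin (C := Faces m) (funext fun k ↦ ?_)
  fin_cases k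
  · exact map_faceOfList _ x []
  · exact map_faceOfList _ x [y]
  · exact map_faceOfList _ x [y, z]

/-- The chain-level subdivision map in degree 2. -/
def subdivide (g : (SimplexCategory.sd.{u}.obj ⦋n⦌) _⦋2⦌ → ZMod 2) (x y z : Fin (n + 1)) : ZMod 2 :=
  g (flag x y z) + g (flag x z y) + g (flag y x z) + g (flag y z x) + g (flag z x y) +
    g (flag z y x)

lemma IsCocycle.apply_flag {g : (SimplexCategory.sd.{u}.obj ⦋n⦌) _⦋2⦌ → ZMod 2} (hg : IsCocycle g)
    (x y z : Fin (n + 1)) :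
    g (flag x y z) =
      nerveCochain (P := Faces n) g (faceOfList x [y]) (faceOfList x [y, z]) (topFace n) +
      nerveCochain (P := Faces n) g (faceOfList x []) (faceOfList x [y, z]) (topFace n) +
      nerveCochain (P := Faces n) g (faceOfList x []) (faceOfList x [y]) (topFace n) := by
  have := IsCocycle.nerveCochain_tetrahedron (P := Faces n) hg (a := faceOfList x [])
    (b := faceOfList x [y]) (c := faceOfList x [y, z]) (d := topFace n)
    (faceOfList_le (by simp)) (faceOfList_le (by simp)) (le_topFace _)
  rw [nerveCochain_eq (P := Faces n) g (a := faceOfList x [])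
    (b := faceOfList x [y]) (c := faceOfList x [y, z])
    (faceOfList_le (by simp)) (faceOfList_le (by simp))] at this
  change g (nerveTriangle (P := Faces n) _ _) = _
  grind

/-- Each flag is coned off to the maximal face. Summed over the six flags, the interior terms occur
twice and cancel; the terms left over depend on single edges of the triangle. -/
lemma IsCocycle.exists_subdivide_eq {g : (SimplexCategory.sd.{u}.obj ⦋n⦌) _⦋2⦌ → ZMod 2}
    (hg : IsCocycle g) : ∃ b : Fin (n + 1) → Fin (n + 1) → ZMod 2,
      ∀ x y z, subdivide g x y z = b x y + b y z + b x z := by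
  refine ⟨fun x y ↦
    nerveCochain (P := Faces n) g (faceOfList x []) (faceOfList x [y]) (topFace n) +
    nerveCochain (P := Faces n) g (faceOfList y []) (faceOfList x [y]) (topFace n),
    fun x y z ↦ ?_⟩
  have h2 (x y : Fin (n + 1)) : faceOfList.{u} x [y] = faceOfList y [x] :=
    faceOfList_congr (by simp) (by simp)
  have h3 (x y z : Fin (n + 1)) : faceOfList.{u} x [y, z] = faceOfList x [z, y] :=
    faceOfList_congr (by simp) (by simp)
  have h4 (x y z : Fin (n + 1)) : faceOfList.{u} x [y, z] = faceOfList y [x, z] :=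
    faceOfList_congr (by simp) (by simp)
  simp only [subdivide, hg.apply_flag]
  rw [h3 x z y, h4 y x z, h3 y z x, h4 y x z, h4 z x y, h3 x z y, h3 z y x, h4 z x y, h3 x z y,
    h2 y x, h2 z x, h2 z y]
  grind

end Subdivision

section LastVertex

/-- The maximal element of a face. -/
noncomputable def lastVertexMap (n : ℕ) : Faces.{u} n →o Fin (n + 1) where
  toFun a := a.finset.sup' a.nonempty ULift.down
  monotone' _ _ hab := Finset.sup'_mono _ hab _

lemma lastVertexMap_faceOfList {n : ℕ} (x : Fin (n + 1)) (l : List (Fin (n + 1))) (y : Fin (n + 1))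
    (hy : y ∈ x :: l) (h : ∀ z ∈ x :: l, z ≤ y) :
    lastVertexMap.{u} n (faceOfList x l) = y := by
  apply le_antisymm
  · refine Finset.sup'_le (NonemptyFiniteChains.nonempty _) _ fun z hz ↦ ?_
    simp only [faceOfList, List.mem_toFinset, List.mem_map] at hz
    obtain ⟨z, hz, rfl⟩ := hz
    exact h z hz
  · refine Finset.le_sup' (f := ULift.down) (b := ULift.up y) ?_
    simp only [faceOfList, List.mem_toFinset, List.mem_map]
    exact ⟨y, hy, rfl⟩

lemma lastVertexMap_map {n m : ℕ} (f : (⦋n⦌ : SimplexCategory) ⟶ ⦋m⦌)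
    (g : ULift.{u} (Fin (n + 1)) →o ULift.{u} (Fin (m + 1)))
    (hg : ∀ x, (g x).down = f.toOrderHom x.down) (a : Faces.{u} n) :
    lastVertexMap m (a.map g) = f.toOrderHom (lastVertexMap n a) := by
  apply le_antisymm
  · refine Finset.sup'_le (NonemptyFiniteChains.nonempty _) _ fun z hz ↦ ?_
    obtain ⟨z, hz', rfl⟩ := (NonemptyFiniteChains.mem_map_iff _ _ _).1 hz
    rw [hg]
    have : z.down ≤ lastVertexMap n a := Finset.le_sup' (f := ULift.down) hz'
    exact f.toOrderHom.monotone this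
  · obtain ⟨z, hz, h⟩ := Finset.exists_mem_eq_sup' a.nonempty ULift.down
    change f.toOrderHom (a.finset.sup' a.nonempty ULift.down) ≤ _
    rw [h, ← hg]
    exact Finset.le_sup' (f := ULift.down) ((NonemptyFiniteChains.mem_map_iff _ _ _).2 ⟨z, hz, rfl⟩)

/-- The last vertex map from the subdivision of the standard simplex. -/
noncomputable def lastVertex : SimplexCategory.sd.{u} ⟶ SSet.stdSimplex where
  app n :=
    { app m := ↾fun (F : Fin (m.unop.len + 1) ⥤ Faces.{u} n.len) ↦
        stdSimplex.objMk ((lastVertexMap n.len).comp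
          ⟨F.obj, fun _ _ h ↦ leOfHom (F.map (homOfLE h))⟩)
      naturality m m' f := by
        ext F
        rfl }
  naturality n m f := by
    ext ⟨k⟩ F
    induction n using SimplexCategory.rec with | _ n
    induction m using SimplexCategory.rec with | _ m
    apply stdSimplex.objEquiv.injective
    ext l : 3
    exact lastVertexMap_map f _ (fun _ ↦ rfl) _

/-- The natural map `X ⟶ Ex X`. -/
noncomputable def toEx : 𝟭 SSet.{u} ⟶ SSet.ex where
  app X :=
    { app n := ↾fun x ↦ ULift.up (lastVertex.app n.unop ≫ yonedaEquiv.symm x)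
      naturality n m f := by
        ext x : 3
        apply ULift.down_injective
        change lastVertex.app m.unop ≫ yonedaEquiv.symm (X.map f x) =
          SimplexCategory.sd.map f.unop ≫ lastVertex.app n.unop ≫ yonedaEquiv.symm x
        exact (congr_arg (lastVertex.app m.unop ≫ ·)
          (yonedaEquiv_symm_naturality_left f.unop x).symm).trans
            (lastVertex.naturality_assoc f.unop _).symm }
  naturality X Y f := by
    ext n x : 4
    apply ULift.down_injective
    change lastVertex.app n.unop ≫ yonedaEquiv.symm (f.app n x) =
      (lastVertex.app n.unop ≫ yonedaEquiv.symm x) ≫ f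
    rw [Category.assoc, yonedaEquiv_symm_comp]

lemma lastVertex_flag {n : ℕ} (x y z : Fin (n + 1)) (i : Fin 3) :
    (show Δ[n] _⦋2⦌ from (lastVertex.app ⦋n⦌).app (op ⦋2⦌) (flag.{u} x y z)) i =
      lastVertexMap.{u} n (![faceOfList x [], faceOfList x [y], faceOfList x [y, z]] i) := by
  fin_cases i <;> rfl

end LastVertex

lemma subdivide_map {n m : ℕ} (f : (⦋n⦌ : SimplexCategory) ⟶ ⦋m⦌)
    (g : (SimplexCategory.sd.{u}.obj ⦋m⦌) _⦋2⦌ → ZMod 2) (x y z : Fin (n + 1)) :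
    subdivide (fun s ↦ g ((SimplexCategory.sd.{u}.map f).app (op ⦋2⦌) s)) x y z =
      subdivide g (f.toOrderHom x) (f.toOrderHom y) (f.toOrderHom z) := by
  simp only [subdivide, sd_map_flag]

/-- The extension of a cocycle along `X ⟶ Ex X`. -/
noncomputable def exCochain {X : SSet.{u}} (c : X _⦋2⦌ → ZMod 2) (t : (SSet.ex.obj X) _⦋2⦌) :
    ZMod 2 :=
  subdivide (fun s ↦ c (t.down.app (op ⦋2⦌) s)) 0 1 2

lemma exCochain_map {X : SSet.{u}} (c : X _⦋2⦌ → ZMod 2) {n : ℕ} (t : (SSet.ex.obj X) _⦋n⦌)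
    (f : (⦋2⦌ : SimplexCategory) ⟶ ⦋n⦌) :
    exCochain c ((SSet.ex.obj X).map f.op t) =
      subdivide (fun s ↦ c (t.down.app (op ⦋2⦌) s)) (f.toOrderHom 0) (f.toOrderHom 1)
        (f.toOrderHom 2) :=
  subdivide_map f (fun s ↦ c (t.down.app (op ⦋2⦌) s)) 0 1 2

lemma isCocycle_exCochain {X : SSet.{u}} {c : X _⦋2⦌ → ZMod 2} (hc : IsCocycle c) :
    IsCocycle (exCochain c) where
  σ i e := by
    refine (exCochain_map c e (SimplexCategory.σ i)).trans ?_
    fin_cases i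
    · change subdivide _ 0 0 1 = 0
      simp only [subdivide]
      grind
    · change subdivide _ 0 1 1 = 0
      simp only [subdivide]
      grind
  δ t := by
    obtain ⟨b, hb⟩ := (hc.comp t.down).exists_subdivide_eq
    have h (i : Fin 4) := (exCochain_map c t (SimplexCategory.δ i)).trans (hb _ _ _)
    refine (congr_arg₂ _ (congr_arg₂ _ (congr_arg₂ _ (h 0) (h 1)) (h 2)) (h 3)).trans ?_
    change b 1 2 + b 2 3 + b 1 3 + (b 0 2 + b 2 3 + b 0 3) + (b 0 1 + b 1 3 + b 0 3) +
      (b 0 1 + b 1 2 + b 0 2) = 0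
    grind

lemma IsCocycle.eq_zero_of_apply_zero_eq {n : ℕ} {d : (Δ[n] : SSet.{u}) _⦋2⦌ → ZMod 2}
    (hd : IsCocycle d)
    (s : Δ[n] _⦋2⦌) (h : s 0 = s 1) : d s = 0 := by
  have hs : s = (SSet.stdSimplex.obj ⦋n⦌).σ 0 ((SSet.stdSimplex.obj ⦋n⦌).δ 0 s) := by
    ext k : 1
    change s k = s ((0 : Fin 3).succAbove ((0 : Fin 2).predAbove k))
    fin_cases k
    · exact h
    · rfl
    · rfl
  rw [hs]
  exact hd.σ _ _

lemma IsCocycle.eq_zero_of_apply_one_eq {n : ℕ} {d : (Δ[n] : SSet.{u}) _⦋2⦌ → ZMod 2}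
    (hd : IsCocycle d)
    (s : Δ[n] _⦋2⦌) (h : s 1 = s 2) : d s = 0 := by
  have hs : s = (SSet.stdSimplex.obj ⦋n⦌).σ 1 ((SSet.stdSimplex.obj ⦋n⦌).δ 1 s) := by
    ext k : 1
    change s k = s ((1 : Fin 3).succAbove ((1 : Fin 2).predAbove k))
    fin_cases k
    · rfl
    · exact h
    · rfl
  rw [hs]
  exact hd.σ _ _

/-- The last vertex map sends the flag of `x, y, z` to the simplex with vertices `x`, `x ⊔ y`, `x ⊔
y ⊔ z`. This is degenerate for every permutation of `0, 1, 2` except the identity. -/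
lemma exCochain_toEx {X : SSet.{u}} {c : X _⦋2⦌ → ZMod 2} (hc : IsCocycle c) (s : X _⦋2⦌) :
    exCochain c ((toEx.app X).app _ s) = c s := by
  let d (t : Δ[2] _⦋2⦌) : ZMod 2 := c ((yonedaEquiv.symm s).app _ t)
  have hd : IsCocycle d := hc.comp (yonedaEquiv.symm s)
  let t (x y z : Fin 3) : Δ[2] _⦋2⦌ := (lastVertex.app ⦋2⦌).app (op ⦋2⦌) (flag.{u} x y z)
  have ht (x y z : Fin 3) : t x y z 0 = x ∧ t x y z 1 = x ⊔ y ∧ t x y z 2 = x ⊔ y ⊔ z := by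
    refine ⟨?_, ?_, ?_⟩
    · refine (lastVertex_flag x y z 0).trans (lastVertexMap_faceOfList x [] x ?_ ?_) <;>
      decide +revert
    · refine (lastVertex_flag x y z 1).trans (lastVertexMap_faceOfList x [y] (x ⊔ y) ?_ ?_) <;>
      decide +revert
    · refine (lastVertex_flag x y z 2).trans (lastVertexMap_faceOfList x [y, z]
        (x ⊔ y ⊔ z) ?_ ?_) <;>
      decide +revert
  have h : t 0 1 2 = SSet.yonedaEquiv (𝟙 _) := by
    ext k : 1
    obtain ⟨h0, h1, h2⟩ := ht 0 1 2
    fin_cases k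
    · exact h0
    · exact h1
    · exact h2
  change d (t 0 1 2) + d (t 0 2 1) + d (t 1 0 2) + d (t 1 2 0) + d (t 2 0 1) + d (t 2 1 0) = _
  rw [hd.eq_zero_of_apply_one_eq (t 0 2 1) (by simp only [ht]; rfl),
    hd.eq_zero_of_apply_zero_eq (t 1 0 2) (by simp only [ht]; rfl),
    hd.eq_zero_of_apply_one_eq (t 1 2 0) (by simp only [ht]; rfl),
    hd.eq_zero_of_apply_zero_eq (t 2 0 1) (by simp only [ht]; rfl),
    hd.eq_zero_of_apply_zero_eq (t 2 1 0) (by simp only [ht]; rfl), h]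
  simp [d]

/-! ### Invariants of maps `f` for which `Ex² f` is a weak equivalence -/

open CartesianMonoidalCategory

namespace Cohomologous

variable {X Y : SSet.{u}} {c d e : X _⦋2⦌ → ZMod 2}

lemma refl (c : X _⦋2⦌ → ZMod 2) : Cohomologous c c :=
  ⟨fun _ ↦ 0, fun s ↦ by grind⟩

lemma symm (h : Cohomologous c d) : Cohomologous d c := by
  obtain ⟨b, hb⟩ := h
  exact ⟨b, fun s ↦ by rw [add_comm, hb]⟩

lemma trans (h : Cohomologous c d) (h' : Cohomologous d e) : Cohomologous c e := by
  obtain ⟨b, hb⟩ := h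
  obtain ⟨b', hb'⟩ := h'
  refine ⟨fun s ↦ b s + b' s, fun s ↦ ?_⟩
  have := hb s
  have := hb' s
  grind

lemma comp {c d : Y _⦋2⦌ → ZMod 2} (h : Cohomologous c d) (f : X ⟶ Y) :
    Cohomologous (fun s ↦ c (f.app (op ⦋2⦌) s)) (fun s ↦ d (f.app (op ⦋2⦌) s)) := by
  obtain ⟨b, hb⟩ := h
  refine ⟨fun s ↦ b (f.app (op ⦋1⦌) s), fun s ↦ ?_⟩
  simp only [SSet.δ_naturality_apply]
  exact hb _

end Cohomologous

lemma cohomologous_of_mk_eq {X : SSet.{u}} {f g : X ⟶ eilenbergMacLane.{u}}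
    (h : (Quot.mk _ f : HomotopyClasses X eilenbergMacLane) = Quot.mk _ g) :
    Cohomologous (cocycleOf f) (cocycleOf g) := by
  replace h := Quot.eqvGen_exact h
  induction h with
  | rel _ _ h => exact cohomologous_of_homotopy h.some
  | refl _ => exact .refl _
  | symm _ _ _ h => exact h.symm
  | trans _ _ _ _ _ h h' => exact h.trans h'

lemma eq_of_mk_eq {X : SSet.{u}} {f g : X ⟶ constBool.{u}}
    (h : (Quot.mk _ f : HomotopyClasses X constBool) = Quot.mk _ g) : f = g := by
  replace h := Quot.eqvGen_exact h
  induction h with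
  | rel _ _ h => exact eq_of_homotopy_constBool h.some
  | refl _ => rfl
  | symm _ _ _ h => exact h.symm
  | trans _ _ _ _ _ h h' => exact h.trans h'

/-- The natural map `X ⟶ Ex² X`. -/
noncomputable def toExSq (X : SSet.{u}) : X ⟶ SSet.ex.obj (SSet.ex.obj X) :=
  toEx.app X ≫ toEx.app (SSet.ex.obj X)

lemma toExSq_naturality {X Y : SSet.{u}} (f : X ⟶ Y) :
    f ≫ toExSq Y = toExSq X ≫ SSet.ex.map (SSet.ex.map f) :=
  (toEx ≫ Functor.whiskerLeft SSet.ex toEx).naturality f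

/-- If `Ex² f` is a weak equivalence, any cocycle on the source of `f` is cohomologous to one
that comes from the target. -/
lemma exists_cocycle_of_weakEquivalence {X Y : SSet.{u}} {f : X ⟶ Y}
    (hf : kanQuillenWeakEquivalences (SSet.ex.map (SSet.ex.map f)))
    {c : X _⦋2⦌ → ZMod 2} (hc : IsCocycle c) :
    ∃ d : Y _⦋2⦌ → ZMod 2, IsCocycle d ∧ Cohomologous c (fun s ↦ d (f.app (op ⦋2⦌) s)) := by
  -- Surjectivity on homotopy classes suffices: the class of the extended cocycle is lifted to `Ex²
  -- Y`, then pulled back along `toExSq Y`.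
  obtain ⟨g, hg⟩ := (hf eilenbergMacLane inferInstance).2
    (Quot.mk _ (classifyingMap (isCocycle_exCochain (isCocycle_exCochain hc))))
  obtain ⟨g, rfl⟩ := Quot.mk_surjective g
  have h : Cohomologous _ (cocycleOf (SSet.ex.map (SSet.ex.map f) ≫ g)) :=
    (cohomologous_of_mk_eq hg).symm
  replace h : Cohomologous _ (cocycleOf (toExSq X ≫ SSet.ex.map (SSet.ex.map f) ≫ g)) :=
    h.comp (toExSq X)
  rw [← reassoc_of% (toExSq_naturality f), cocycleOf_classifyingMap] at h
  have hX : (fun s ↦ exCochain (exCochain c) ((toExSq X).app (op ⦋2⦌) s)) = c := funext fun s ↦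
    (exCochain_toEx (isCocycle_exCochain hc) ((toEx.app X).app _ s)).trans (exCochain_toEx hc s)
  rw [hX] at h
  exact ⟨_, isCocycle_cocycleOf (toExSq Y ≫ g), h⟩

/-- The vertex of `X` attached to a simplex of `Ex X` by evaluation at the maximal face. -/
noncomputable def exVertex {X : SSet.{u}} {n : SimplexCategoryᵒᵖ}
    (t : (SSet.ex.obj X).obj n) : X _⦋0⦌ :=
  t.down.app (op ⦋0⦌) (ComposableArrows.mk₀ (topFace n.unop.len))

lemma nerve_constBool_eq {P : Type u} [PartialOrder P] (φ : nerve P ⟶ constBool.{u})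
    (v w : ComposableArrows P 0) (h : v.obj 0 ≤ w.obj 0) :
    φ.app (op ⦋0⦌) v = φ.app (op ⦋0⦌) w := by
  let e : (nerve P) _⦋1⦌ := ComposableArrows.mk₁ (homOfLE h)
  have hv : v = (nerve P).δ 1 e := nerve.ext_of_isThin (n := op ⦋0⦌) (by
    funext (k : Fin 1)
    obtain rfl := Subsingleton.elim k 0
    rfl)
  have hw : w = (nerve P).δ 0 e := nerve.ext_of_isThin (n := op ⦋0⦌) (by
    funext (k : Fin 1)
    obtain rfl := Subsingleton.elim k 0
    rfl)
  rw [hv, hw]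
  exact (constBool_app_map φ (SimplexCategory.δ 1).op e).trans
    (constBool_app_map φ (SimplexCategory.δ 0).op e).symm

/-- The extension of a map `X ⟶ constBool` along `X ⟶ Ex X`. -/
noncomputable def exConstBool {X : SSet.{u}} (φ : X ⟶ constBool.{u}) :
    SSet.ex.obj X ⟶ constBool.{u} where
  app n := ↾fun t ↦ φ.app (op ⦋0⦌) (exVertex t)
  naturality n m f := by
    ext t : 3
    exact nerve_constBool_eq (P := Faces n.unop.len) (t.down ≫ φ) _ _ (le_topFace _)

lemma toEx_exConstBool {X : SSet.{u}} (φ : X ⟶ constBool.{u}) :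
    toEx.app X ≫ exConstBool φ = φ := by
  ext n x : 4
  exact constBool_app_map φ _ x

/-- If `Ex² f` is a weak equivalence, any map from the source of `f` to `constBool` extends
to the target. -/
lemma exists_map_constBool_of_weakEquivalence {X Y : SSet.{u}} {f : X ⟶ Y}
    (hf : kanQuillenWeakEquivalences (SSet.ex.map (SSet.ex.map f))) (φ : X ⟶ constBool.{u}) :
    ∃ ψ : Y ⟶ constBool.{u}, f ≫ ψ = φ := by
  obtain ⟨g, hg⟩ := (hf constBool inferInstance).2 (Quot.mk _ (exConstBool (exConstBool φ)))
  obtain ⟨g, rfl⟩ := Quot.mk_surjective g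
  refine ⟨toExSq Y ≫ g, ?_⟩
  have h : SSet.ex.map (SSet.ex.map f) ≫ g = _ := eq_of_mk_eq hg
  rw [reassoc_of% (toExSq_naturality f), h, toExSq, Category.assoc,
    toEx_exConstBool, toEx_exConstBool]

/-- If `Ex² f` is a weak equivalence and the target of `f` is nonempty, then so is the source. -/
lemma nonempty_of_weakEquivalence {X Y : SSet.{u}} {f : X ⟶ Y}
    (hf : kanQuillenWeakEquivalences (SSet.ex.map (SSet.ex.map f))) (y : Y _⦋0⦌) :
    Nonempty (X _⦋0⦌) := by
  by_contra hX
  rw [not_nonempty_iff] at hX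
  let g (b : Bool) : SSet.ex.obj (SSet.ex.obj Y) ⟶ constBool := { app _ := ↾fun _ ↦ ULift.up b }
  have h : g true = g false := eq_of_mk_eq ((hf constBool inferInstance).1 (by
    -- A simplex of `Ex² X` would give a vertex of `X`, so the two constant maps agree on `Ex² X`.
    refine congr_arg (Quot.mk _) ?_
    ext n x
    exact hX.elim (exVertex (exVertex x))))
  cases ULift.up_injective
    (ConcreteCategory.congr_hom (congr_app h (op ⦋0⦌)) ((toExSq Y).app (op ⦋0⦌) y))

/-! ### `Ex²` of homotopy equivalences, and posets with a least element -/

/-- The comparison map `Ex X ⊗ Ex Y ⟶ Ex (X ⊗ Y)`. -/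
noncomputable def exTensor (X Y : SSet.{u}) :
    SSet.ex.obj X ⊗ SSet.ex.obj Y ⟶ SSet.ex.obj (X ⊗ Y) where
  app n := ↾fun x ↦ ULift.up (lift x.1.down x.2.down)
  naturality n m f := by
    ext x : 3
    exact congr_arg ULift.up (comp_lift (SimplexCategory.sd.map f.unop) x.1.down x.2.down).symm

lemma toEx_const_apply {X Y : SSet.{u}} (v : Y _⦋0⦌) {n : SimplexCategoryᵒᵖ} (x : X.obj n) :
    ((toEx.app Y).app n ((const v : X ⟶ Y).app n x)).down = const v := by
  have h : yonedaEquiv.symm ((const v : X ⟶ Y).app n x) = const v := by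
    rw [Equiv.symm_apply_eq]
    rfl
  exact congr_arg (lastVertex.app n.unop ≫ ·) h

lemma lift_const_exTensor {X Y Z : SSet.{u}} (v : Y _⦋0⦌) (h : X ⊗ Y ⟶ Z) :
    lift (𝟙 _) (const v) ≫ (SSet.ex.obj X ◁ toEx.app Y) ≫ exTensor X Y ≫ SSet.ex.map h =
      SSet.ex.map (lift (𝟙 X) (const v) ≫ h) := by
  suffices h : lift (𝟙 _) (const v) ≫ (SSet.ex.obj X ◁ toEx.app Y) ≫ exTensor X Y =
      SSet.ex.map (lift (𝟙 X) (const v)) by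
    rw [Functor.map_comp, ← h, Category.assoc, Category.assoc]
  ext n x : 4
  refine congr_arg ULift.up ?_
  change lift x.down ((toEx.app Y).app n ((const v : SSet.ex.obj X ⟶ Y).app n x)).down = x.down ≫ _
  rw [toEx_const_apply, comp_lift, Category.comp_id]
  rfl

lemma kanQuillenWeakEquivalences_of_homotopy {X Y : SSet.{u}} (f : X ⟶ Y) (s : Y ⟶ X)
    (hs : s ≫ f = 𝟙 Y) (h : X ⊗ Δ[1] ⟶ X) (h₀ : ι₀ ≫ h = f ≫ s) (h₁ : ι₁ ≫ h = 𝟙 X) :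
    kanQuillenWeakEquivalences f := by
  intro Z _
  refine Function.bijective_iff_has_inverse.2 ⟨HomotopyClasses.precomp s Z, ?_, ?_⟩
  · rintro ⟨g⟩
    refine congr_arg (Quot.mk _) ?_
    change s ≫ f ≫ g = g
    rw [reassoc_of% hs]
  · rintro ⟨g⟩
    refine Quot.sound ⟨{ h := h ≫ g, h₀ := ?_, h₁ := ?_, rel := ?_ }⟩
    · rw [reassoc_of% h₀]
      rfl
    · rw [reassoc_of% h₁]
      rfl
    · ext n x
      exact x.1.2.elim

/-- `Ex` carries homotopies to homotopies through `Ex X ⊗ Δ[1] ⟶ Ex X ⊗ Ex Δ[1] ⟶ Ex (X ⊗ Δ[1])`;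
`lift_const_exTensor` identifies the endpoints. -/
lemma exSq_of_homotopy {X Y : SSet.{u}} (f : X ⟶ Y) (s : Y ⟶ X)
    (hs : s ≫ f = 𝟙 Y) (h : X ⊗ Δ[1] ⟶ X) (h₀ : ι₀ ≫ h = f ≫ s) (h₁ : ι₁ ≫ h = 𝟙 X) :
    kanQuillenWeakEquivalences (SSet.ex.map (SSet.ex.map f)) := by
  refine kanQuillenWeakEquivalences_of_homotopy _ (SSet.ex.map (SSet.ex.map s))
    (by simp only [← Functor.map_comp, hs, CategoryTheory.Functor.map_id])
    ((_ ◁ toEx.app Δ[1]) ≫ exTensor _ _ ≫ SSet.ex.map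
      ((_ ◁ toEx.app Δ[1]) ≫ exTensor _ _ ≫ SSet.ex.map h)) ?_ ?_
  · simp only [ι₀, lift_const_exTensor]
    rw [← ι₀, h₀]
    simp only [Functor.map_comp]
  · simp only [ι₁, lift_const_exTensor]
    rw [← ι₁, h₁]
    simp only [CategoryTheory.Functor.map_id]

/-- The contraction of the nerve of a partial order to its least element. -/
def nerveContraction (P : Type u) [PartialOrder P] [OrderBot P] : nerve P ⊗ Δ[1] ⟶ nerve P where
  app n := ↾fun x ↦
    { obj k := if (stdSimplex.objEquiv x.2).toOrderHom k = 0 then ⊥ else x.1.obj k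
      map {k l} f := homOfLE (by
        have h₁ := leOfHom (x.1.map f)
        have h₂ := (stdSimplex.objEquiv x.2).toOrderHom.monotone (leOfHom f)
        split_ifs with h h' h'
        · rfl
        · exact bot_le
        · rw [h'] at h₂
          exact (h (Fin.le_zero_iff.1 h₂)).elim
        · exact h₁) }
  naturality n m f := by
    ext x : 3
    rfl

lemma thomasonWeakEquivalences_of_orderBot (P : Type u) [PartialOrder P] [OrderBot P]
    (f : Cat.of P ⟶ 𝟙_ Cat.{u, u}) : thomasonWeakEquivalences f := by
  let s : 𝟙_ Cat.{u, u} ⟶ Cat.of P := Functor.toCatHom (C := (𝟙_ Cat.{u, u} : Cat.{u, u}))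
    ((Functor.const _).obj (⊥ : P))
  refine exSq_of_homotopy (nerveFunctor.map f) (nerveFunctor.map s) ?_ (nerveContraction P) ?_ ?_
  · rw [← Functor.map_comp, ← CategoryTheory.Functor.map_id]
    exact congr_arg _ (toUnit_unique _ _)
  · ext n x : 4
    exact nerve.ext_of_isThin (C := P) (funext fun k ↦
      (if_pos rfl : (if (0 : Fin 2) = 0 then (⊥ : P) else x.obj k) = ⊥))
  · ext n x : 4
    exact nerve.ext_of_isThin (C := P) (funext fun k ↦
      (if_neg one_ne_zero : (if (1 : Fin 2) = 0 then (⊥ : P) else x.obj k) = x.obj k))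

/-! ### Cocycles and invariant predicates on categories -/

/-- A normalized 2-cocycle modulo 2 on a category. -/
structure IsCatCocycle {C : Type*} [Category* C]
    (c : ∀ ⦃x y z : C⦄, (x ⟶ y) → (y ⟶ z) → ZMod 2) : Prop where
  id_left {x y : C} (f : x ⟶ y) : c (𝟙 x) f = 0
  id_right {x y : C} (f : x ⟶ y) : c f (𝟙 y) = 0
  relation {x y z t : C} (f : x ⟶ y) (g : y ⟶ z) (h : z ⟶ t) :
    c g h + c (f ≫ g) h + c f (g ≫ h) + c f g = 0

lemma IsCatCocycle.isCocycle {C : Type u} [Category.{u} C]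
    {c : ∀ ⦃x y z : C⦄, (x ⟶ y) → (y ⟶ z) → ZMod 2} (hc : IsCatCocycle c) :
    IsCocycle (X := nerve C) (fun s ↦ c (s.map (homOfLE (Fin.zero_le (1 : Fin 3))))
      (s.map (homOfLE (Fin.le_last (1 : Fin 3))))) where
  σ i e := by
    fin_cases i
    · exact (congr_arg (c · _) (e.map_id 0)).trans (hc.id_left _)
    · exact (congr_arg (c _) (e.map_id 1)).trans (hc.id_right _)
  δ x := by
    have := hc.relation (x.map (homOfLE (by decide : (0 : Fin 4) ≤ 1)))
      (x.map (homOfLE (by decide : (1 : Fin 4) ≤ 2)))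
      (x.map (homOfLE (by decide : (2 : Fin 4) ≤ 3)))
    rw [← x.map_comp, ← x.map_comp] at this
    exact this

lemma nerve_eq_mk₂ {C : Type u} [Category.{u} C] (s : (nerve C) _⦋2⦌) :
    s = ComposableArrows.mk₂ (s.map (homOfLE (Fin.zero_le (1 : Fin 3))))
      (s.map (homOfLE (Fin.le_last (1 : Fin 3)))) := by
  obtain ⟨_, _, _, _, _, rfl⟩ := ComposableArrows.mk₂_surjective s
  rfl

lemma IsCocycle.isCatCocycle {C : Type u} [Category.{u} C] {d : (nerve C) _⦋2⦌ → ZMod 2}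
    (hd : IsCocycle d) :
    IsCatCocycle (fun (_ _ _ : C) f g ↦ d (ComposableArrows.mk₂ f g)) where
  id_left f := (congr_arg d (nerve_eq_mk₂ ((nerve C).σ 0 (ComposableArrows.mk₁ f)))).symm.trans
    (hd.σ 0 (ComposableArrows.mk₁ f))
  id_right f := (congr_arg d (nerve_eq_mk₂ ((nerve C).σ 1 (ComposableArrows.mk₁ f)))).symm.trans
    (hd.σ 1 (ComposableArrows.mk₁ f))
  relation f g h := by
    have := hd.δ (ComposableArrows.mk₃ f g h)
    rwa [nerve_eq_mk₂ ((nerve C).δ 0 (ComposableArrows.mk₃ f g h)),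
      nerve_eq_mk₂ ((nerve C).δ 1 (ComposableArrows.mk₃ f g h)),
      nerve_eq_mk₂ ((nerve C).δ 2 (ComposableArrows.mk₃ f g h)),
      nerve_eq_mk₂ ((nerve C).δ 3 (ComposableArrows.mk₃ f g h))] at this

lemma exists_catCocycle {C D : Type u} [Category.{u} C] [Category.{u} D] {F : C ⥤ D}
    (hF : thomasonWeakEquivalences F.toCatHom)
    {c : ∀ ⦃x y z : C⦄, (x ⟶ y) → (y ⟶ z) → ZMod 2} (hc : IsCatCocycle c) :
    ∃ (d : ∀ ⦃x y z : D⦄, (x ⟶ y) → (y ⟶ z) → ZMod 2) (b : ∀ ⦃x y : C⦄, (x ⟶ y) → ZMod 2),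
      IsCatCocycle d ∧ ∀ ⦃x y z : C⦄ (f : x ⟶ y) (g : y ⟶ z),
        c f g + d (F.map f) (F.map g) = b f + b g + b (f ≫ g) := by
  obtain ⟨d, hd, b, hb⟩ := exists_cocycle_of_weakEquivalence (f := nerveFunctor.map F.toCatHom)
    hF hc.isCocycle
  refine ⟨_, fun x y f ↦ b (ComposableArrows.mk₁ f), hd.isCatCocycle, fun x y z f g ↦ ?_⟩
  have h₁ := hb (ComposableArrows.mk₂ f g)
  have h₂ : (nerveFunctor.map F.toCatHom).app (op ⦋2⦌) (ComposableArrows.mk₂ f g) =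
    ComposableArrows.mk₂ (F.map f) (F.map g) := nerve_eq_mk₂ (C := D) _
  refine (congr_arg (_ + d ·) h₂.symm).trans (h₁.trans ?_)
  exact (congr_arg₂ (· + ·) (congr_arg₂ (· + ·) (congr_arg b (nerve.δ₀_mk₂_eq f g))
    (congr_arg b (nerve.δ₁_mk₂_eq f g))) (congr_arg b (nerve.δ₂_mk₂_eq f g))).trans
      ((add_comm _ _).trans (add_assoc _ _ _).symm)

/-- A predicate on objects that is invariant along morphisms extends along a Thomason weak
equivalence. -/
lemma exists_predicate {C D : Cat.{u, u}} {F : C ⟶ D} (hF : thomasonWeakEquivalences F)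
    (p : C → Prop) (hp : ∀ ⦃x y : C⦄, (x ⟶ y) → (p x ↔ p y)) :
    ∃ q : D → Prop, ∀ x, p x ↔ q (F.toFunctor.obj x) := by
  classical
  let φ : nerve C ⟶ constBool.{u} :=
    { app n := ↾fun s ↦ ULift.up (decide (p (s.obj 0)))
      naturality n m f := by
        ext s : 3
        refine congr_arg ULift.up ?_
        simp only [decide_eq_decide]
        exact (hp (s.map (homOfLE (Fin.zero_le _)))).symm }
  obtain ⟨ψ, hψ⟩ := exists_map_constBool_of_weakEquivalence (f := nerveFunctor.map F) hF φ
  refine ⟨fun y ↦ (ψ.app (op ⦋0⦌) (ComposableArrows.mk₀ y)).down = true, fun x ↦ ?_⟩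
  have h := congr_arg ULift.down
    (ConcreteCategory.congr_hom (congr_app hψ (op ⦋0⦌)) (ComposableArrows.mk₀ x))
  have h₂ : (nerveFunctor.map F).app (op ⦋0⦌) (ComposableArrows.mk₀ x) =
    ComposableArrows.mk₀ (F.toFunctor.obj x) := ComposableArrows.ext₀ rfl
  have h₃ := (congr_arg (fun y ↦ (ψ.app (op ⦋0⦌) y).down) h₂).symm.trans h
  exact decide_eq_true_iff.symm.trans (Eq.congr_left h₃.symm)

lemma nonempty_of_thomasonWeakEquivalence {C D : Cat.{u, u}} {F : C ⟶ D}
    (hF : thomasonWeakEquivalences F) (y : D) : Nonempty C :=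
  (nonempty_of_weakEquivalence (f := nerveFunctor.map F) hF (ComposableArrows.mk₀ y)).map (·.obj 0)

end SimplicialSets

/-! ### The vanishing condition forces split monomorphisms -/

/-- The condition that, for functors `p` and `q` from `J` that agree on `o`, a 2-cocycle `c` on
their target, a morphism `f` from `o` and morphisms `s` and `t` that are identified by both `p f`
and `q f`, the two discrepancies between the values of `c` at `s` and `t` are the same. -/
def HasVanishingSums {J : Type u} [Category.{u} J] (o : J) : Prop :=
  ∀ ⦃V : Type u⦄ [Category.{u} V] (p q : J ⥤ V) ⦃c : ∀ ⦃x y z : V⦄, (x ⟶ y) → (y ⟶ z) → ZMod 2⦄,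
    IsCatCocycle c → ∀ (h : p.obj o = q.obj o) ⦃x : J⦄ (f : o ⟶ x) ⦃v : V⦄ (s t : v ⟶ p.obj o)
    (s' t' : v ⟶ q.obj o), s' = s ≫ eqToHom h → t' = t ≫ eqToHom h →
    s ≫ p.map f = t ≫ p.map f → s' ≫ q.map f = t' ≫ q.map f →
    c s (p.map f) + c t (p.map f) + c s' (q.map f) + c t' (q.map f) = 0

/-- The category with an object `none` and objects `some x` for `x : J`, such that morphisms
between the latter are partial functions with two kinds of undefined values between the sets of
split monomorphisms from `o`, and morphisms from `none` to `some x` are split monomorphisms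
`o ⟶ x` decorated by a boolean, or undefined values. -/
structure Collage {J : Type u} [Category.{u} J] (o : J) : Type u where
  /-- the object of `Option J` -/
  as : Option J

namespace Collage

variable {J : Type u} [Category.{u} J] {o : J}

/-- The type of split monomorphisms from `o` to `x`. -/
abbrev Section (o x : J) : Type u := { h : o ⟶ x // IsSplitMono h }

variable (o) in
/-- The morphisms in the collage. -/
def HomAux : Option J → Option J → Type u
  | none, none => PUnit
  | none, some x => Section o x × Bool ⊕ Bool
  | some _, none => PEmpty
  | some x, some y => Section o x → Section o y ⊕ Bool

/-- The composition in the collage. -/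
def compAux : ∀ {x y z : Option J}, HomAux o x y → HomAux o y z → HomAux o x z
  | none, none, _ => fun _ g ↦ g
  | none, some _, none => fun _ g ↦ g.elim
  | some _, none, _ => fun f _ ↦ f.elim
  | some _, some _, none => fun _ g ↦ g.elim
  | none, some _, some _ => fun f g ↦
      Sum.elim (fun a ↦ Sum.map (fun b ↦ (b, a.2)) id (g a.1)) Sum.inr f
  | some _, some _, some _ => fun f g a ↦ Sum.elim g Sum.inr (f a)

instance : Category.{u} (Collage o) where
  Hom x y := HomAux o x.as y.as
  id := fun
    | ⟨none⟩ => PUnit.unit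
    | ⟨some _⟩ => Sum.inl
  comp := compAux
  id_comp := by
    rintro ⟨_ | x⟩ ⟨_ | y⟩ f
    · rfl
    · rfl
    · exact f.elim
    · rfl
  comp_id := by
    rintro ⟨_ | x⟩ ⟨_ | y⟩ f
    · rfl
    · obtain f | f := f <;> rfl
    · exact f.elim
    · funext a
      change Sum.elim Sum.inl Sum.inr (f a) = f a
      obtain h | h := f a <;> rfl
  assoc := by
    rintro ⟨_ | x⟩ ⟨_ | y⟩ ⟨_ | z⟩ ⟨_ | t⟩ f g h
    all_goals first | rfl | exact f.elim | exact g.elim | exact h.elim | skip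
    · obtain ⟨a, b⟩ | f := f
      · change Sum.elim _ _ (Sum.map _ _ (g a)) = Sum.map _ _ (Sum.elim h Sum.inr (g a))
        obtain k | k := g a <;> rfl
      · rfl
    · funext a
      change Sum.elim h Sum.inr (Sum.elim g Sum.inr (f a)) =
        Sum.elim (fun a ↦ Sum.elim h Sum.inr (g a)) Sum.inr (f a)
      obtain k | k := f a <;> rfl

open Classical in
variable (o) in
/-- The functor from `J` to the collage that sends split monomorphisms which are not split
anymore after postcomposition to a given undefined value. -/
noncomputable def functor (ε : Bool) : J ⥤ Collage o where
  obj x := ⟨some x⟩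
  map {x y} k := fun (h : Section o x) ↦
    if hk : IsSplitMono (h.1 ≫ k) then (Sum.inl ⟨h.1 ≫ k, hk⟩ : Section o y ⊕ Bool) else Sum.inr ε
  map_id x := by
    funext h
    exact (dif_pos (by simpa using h.2)).trans
      (congr_arg Sum.inl (Subtype.ext (Category.comp_id _)))
  map_comp {x y z} k l := by
    funext h
    change dite _ _ _ = Sum.elim _ _ (dite _ _ _)
    by_cases hk : IsSplitMono (h.1 ≫ k)
    · rw [dif_pos hk]
      change _ = dite (IsSplitMono ((h.1 ≫ k) ≫ l)) _ _
      simp only [Category.assoc]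
    -- If `h ≫ k ≫ l` is a split mono, so is `h ≫ k`: an undefined value remains undefined.
    · have hkl : ¬ IsSplitMono (h.1 ≫ k ≫ l) := fun ⟨⟨r⟩⟩ ↦
        hk ⟨⟨⟨l ≫ r.retraction, by rw [← r.id]; simp only [Category.assoc]⟩⟩⟩
      rw [dif_neg hk, dif_neg hkl]
      rfl

/-- The cocycle on the collage. -/
def cocycleAux : ∀ {x y z : Option J}, HomAux o x y → HomAux o y z → ZMod 2
  | none, some _, some _ => fun f g ↦
      Sum.elim (fun a ↦ Sum.elim 0 (fun ε ↦ if a.2 && ε then 1 else 0) (g a.1)) 0 f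
  | _, _, _ => fun _ _ ↦ 0

lemma isCatCocycle : IsCatCocycle (C := Collage o) (fun _ _ _ f g ↦ cocycleAux f g) where
  id_left := by
    rintro ⟨_ | x⟩ ⟨_ | y⟩ f <;> rfl
  id_right := by
    rintro ⟨_ | x⟩ ⟨_ | y⟩ f
    · rfl
    · obtain f | f := f <;> rfl
    · rfl
    · rfl
  relation := by
    rintro ⟨_ | x⟩ ⟨_ | y⟩ ⟨_ | z⟩ ⟨_ | t⟩ f g h
    all_goals first | rfl | exact f.elim | exact g.elim | exact h.elim | skip
    · exact (by grind : ∀ a : ZMod 2, a + a + 0 + 0 = 0) _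
    · change 0 + cocycleAux (compAux f g) h + cocycleAux f (compAux g h) + cocycleAux f g = 0
      obtain ⟨a, b⟩ | f := f
      · change 0 + Sum.elim _ _ (Sum.map _ _ (g a)) + Sum.elim _ _ (Sum.elim _ _ (g a)) +
          Sum.elim _ _ (g a) = 0
        obtain k | k := g a
        · exact (by grind : ∀ a : ZMod 2, 0 + a + a + 0 = 0) _
        · exact (by grind : ∀ a : ZMod 2, 0 + 0 + a + a = 0) _
      · exact (by grind : (0 + 0 + 0 + 0 : ZMod 2) = 0)

end Collage

open Collage in
lemma HasVanishingSums.isSplitMono {J : Type u} [Category.{u} J] {o : J}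
    (ho : HasVanishingSums o) {x : J} (f : o ⟶ x) : IsSplitMono f := by
  by_contra hf
  let r : Section o o := ⟨𝟙 o, inferInstance⟩
  let s (b : Bool) : (⟨none⟩ : Collage o) ⟶ ⟨some o⟩ := (Sum.inl (r, b) : Section o o × Bool ⊕ Bool)
  have hr (ε : Bool) : ((functor o ε).map f : Section o o → Section o x ⊕ Bool) r = Sum.inr ε :=
    dif_neg (by simpa [r] using hf)
  have hs (b ε : Bool) : s b ≫ (functor o ε).map f =
      (Sum.inr ε : Section o x × Bool ⊕ Bool) :=
    congr_arg (Sum.map (fun a ↦ (a, b)) id) (hr ε)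
  -- Both `s false` and `s true` become the undefined value `ε` after `f`. Of the four terms only
  -- the one with decoration `true` and `ε = true` is nonzero.
  have h := ho (functor o true) (functor o false) isCatCocycle rfl f (s false) (s true)
    (s false) (s true) (Category.comp_id _).symm (Category.comp_id _).symm
    ((hs _ _).trans (hs _ _).symm) ((hs _ _).trans (hs _ _).symm)
  have hc (b ε : Bool) : cocycleAux (s b) ((functor o ε).map f) = if b && ε then 1 else 0 :=
    congr_arg (fun y : Section o x ⊕ Bool ↦
      (Sum.elim 0 (fun ε ↦ if b && ε then 1 else 0) y : ZMod 2)) (hr ε)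
  have h' := (congr_arg₂ (· + ·) (congr_arg₂ (· + ·) (congr_arg₂ (· + ·)
    (hc false true) (hc true true)) (hc false false)) (hc true false)).symm.trans h
  simp at h'

/-! ### Extension along the pushout product, and its effect on cocycles -/

/-- `p` and `q` glue to a map from the source of the pushout product of `i` with itself. `P` is the
cobase change of that trivial cofibration along the glued map. -/
lemma IsMonoidalModelCategory.exists_extension {C : Type u} [Category.{v} C] [MonoidalCategory C]
    [MonoidalClosed C] [ModelCategory C] (hC : IsMonoidalModelCategory C) {J V : C}
    {i : 𝟙_ C ⟶ J} (hi : trivialCofibrations C i) {p q : J ⟶ V} (h : i ≫ p = i ≫ q) :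
    ∃ (V' : C) (P : V ⟶ V') (H : J ⊗ J ⟶ V'), WeakEquivalence P ∧
      (ρ_ J).inv ≫ J ◁ i ≫ H = p ≫ P ∧ (λ_ J).inv ≫ i ▷ J ≫ H = q ≫ P := by
  have hT := hC.acyclic_left i i hi hi.1
  let sq := Functor.PushoutObjObj.ofHasPushout (curriedTensor C) i i
  replace hT : trivialCofibrations C sq.ι := hT
  have hp : i ▷ 𝟙_ C ≫ (ρ_ J).hom ≫ p = 𝟙_ C ◁ i ≫ (λ_ J).hom ≫ q := by
    rw [rightUnitor_naturality_assoc, leftUnitor_naturality_assoc, h, unitors_equal]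
  let d : sq.pt ⟶ V := sq.isPushout.desc ((ρ_ J).hom ≫ p) ((λ_ J).hom ≫ q) hp
  have hl : sq.inl ≫ d = (ρ_ J).hom ≫ p := sq.isPushout.inl_desc _ _ hp
  have hr : sq.inr ≫ d = (λ_ J).hom ≫ q := sq.isPushout.inr_desc _ _ hp
  have hT' := (mem_trivialCofibrations_iff _).1 hT
  refine ⟨Limits.pushout d sq.ι, Limits.pushout.inl d sq.ι, Limits.pushout.inr d sq.ι, ?_, ?_, ?_⟩
  · have := hT'.1
    have := hT'.2
    infer_instance
  · have h₁ : sq.inl ≫ sq.ι = J ◁ i := sq.inl_ι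
    rw [← h₁, Category.assoc, ← Limits.pushout.condition, reassoc_of% hl, Iso.inv_hom_id_assoc]
  · have h₁ : sq.inr ≫ sq.ι = i ▷ J := sq.inr_ι
    rw [← h₁, Category.assoc, ← Limits.pushout.condition, reassoc_of% hr, Iso.inv_hom_id_assoc]

lemma IsCatCocycle.op {C : Type*} [Category* C] {c : ∀ ⦃x y z : C⦄, (x ⟶ y) → (y ⟶ z) → ZMod 2}
    (hc : IsCatCocycle c) :
    IsCatCocycle (C := Cᵒᵖ) (fun _ _ _ f g ↦ c g.unop f.unop) where
  id_left _ := hc.id_right _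
  id_right _ := hc.id_left _
  relation f g h := by
    have := hc.relation h.unop g.unop f.unop
    simp only [unop_comp]
    grind

/-- The relations for `s, f, m` and `t, f, m` give `c s f + c t f = c s (f ≫ m) + c t (f ≫ m)`,
which depends only on `f ≫ m`. -/
lemma IsCatCocycle.sum_eq_zero {C : Type*} [Category* C]
    {c : ∀ ⦃x y z : C⦄, (x ⟶ y) → (y ⟶ z) → ZMod 2}
    (hc : IsCatCocycle c) {v y x x' z : C} {f : y ⟶ x} {f' : y ⟶ x'}
    {m : x ⟶ z} {m' : x' ⟶ z} (hm : f ≫ m = f' ≫ m') {s t : v ⟶ y}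
    (hst : s ≫ f = t ≫ f) (hst' : s ≫ f' = t ≫ f') :
    c s f + c t f + c s f' + c t f' = 0 := by
  have h₁ := hc.relation s f m
  have h₂ := hc.relation t f m
  have h₃ := hc.relation s f' m'
  have h₄ := hc.relation t f' m'
  rw [hst] at h₁
  rw [hst'] at h₃
  rw [hm] at h₁ h₂
  grind

/-- The coboundary contributes `b s + b t` once for `f` and once for `f'`, so passing from `c` to
the pullback of `d` does not change the sum. -/
lemma IsCatCocycle.sum_eq_zero_of_cohomologous {V V' : Type*} [Category* V] [Category* V']
    {d : ∀ ⦃x y z : V'⦄, (x ⟶ y) → (y ⟶ z) → ZMod 2} (hd : IsCatCocycle d) (P : V ⥤ V')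
    {c : ∀ ⦃x y z : V⦄, (x ⟶ y) → (y ⟶ z) → ZMod 2} {b : ∀ ⦃x y : V⦄, (x ⟶ y) → ZMod 2}
    (hb : ∀ ⦃x y z : V⦄ (f : x ⟶ y) (g : y ⟶ z),
      c f g + d (P.map f) (P.map g) = b f + b g + b (f ≫ g))
    {v y y' x x' : V} {z : V'} (h : y = y') {f : y ⟶ x} {f' : y' ⟶ x'}
    {m : P.obj x ⟶ z} {m' : P.obj x' ⟶ z}
    (hm : P.map f ≫ m = eqToHom (congr_arg P.obj h) ≫ P.map f' ≫ m')
    {s t : v ⟶ y} {s' t' : v ⟶ y'} (hs : s' = s ≫ eqToHom h) (ht : t' = t ≫ eqToHom h)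
    (hst : s ≫ f = t ≫ f) (hst' : s' ≫ f' = t' ≫ f') :
    c s f + c t f + c s' f' + c t' f' = 0 := by
  subst h
  simp only [eqToHom_refl, Category.comp_id, Category.id_comp] at hs ht hm
  subst s' t'
  have h₀ := hd.sum_eq_zero hm (s := P.map s) (t := P.map t)
    (by rw [← P.map_comp, ← P.map_comp, hst]) (by rw [← P.map_comp, ← P.map_comp, hst'])
  have h₁ := hb s f
  have h₂ := hb t f
  have h₃ := hb s f'
  have h₄ := hb t f'
  rw [hst] at h₁
  rw [hst'] at h₃
  grind

/-- The square is closed by `H (x, x)`: both composites are `H` applied to `(f, f)`. -/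
lemma exists_comp_eq {J V : Type*} [Category* J] [Category* V] (H : J × J ⥤ V) {o : J}
    {A B : J ⥤ V} (hA : Prod.sectL J o ⋙ H = A) (hB : Prod.sectR o J ⋙ H = B)
    (h : A.obj o = B.obj o) {x : J} (f : o ⟶ x) :
    ∃ (z : V) (m : A.obj x ⟶ z) (m' : B.obj x ⟶ z), A.map f ≫ m = eqToHom h ≫ B.map f ≫ m' := by
  subst hA hB
  refine ⟨H.obj (x, x), H.map (Prod.mkHom (𝟙 x) f), H.map (Prod.mkHom f (𝟙 x)), ?_⟩
  have e : H.map (Prod.mkHom f (𝟙 o)) ≫ H.map (Prod.mkHom (𝟙 x) f) =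
      H.map (Prod.mkHom (𝟙 o) f) ≫ H.map (Prod.mkHom f (𝟙 x)) := by
    simp [← H.map_comp]
  exact e.trans (Category.id_comp _).symm

lemma exists_eq_comp {J V : Type*} [Category* J] [Category* V] (H : J × J ⥤ V) {o : J}
    {A B : J ⥤ V} (hA : Prod.sectL J o ⋙ H = A) (hB : Prod.sectR o J ⋙ H = B)
    (h : B.obj o = A.obj o) {x : J} (f : x ⟶ o) :
    ∃ (z : V) (m : z ⟶ A.obj x) (m' : z ⟶ B.obj x), m ≫ A.map f = (m' ≫ B.map f) ≫ eqToHom h := by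
  subst hA hB
  refine ⟨H.obj (x, x), H.map (Prod.mkHom (𝟙 x) f), H.map (Prod.mkHom f (𝟙 x)), ?_⟩
  have e : H.map (Prod.mkHom (𝟙 x) f) ≫ H.map (Prod.mkHom f (𝟙 o)) =
      H.map (Prod.mkHom f (𝟙 x)) ≫ H.map (Prod.mkHom (𝟙 o) f) := by
    simp [← H.map_comp]
  exact e.trans (Category.comp_id _).symm

/-- The object of the terminal category. -/
abbrev unitObj : (𝟙_ Cat.{u, u} : Cat.{u, u}) := ⟨⟨⟨⟩⟩⟩

lemma unit_hom_ext {V : Cat.{u, u}} {f g : 𝟙_ Cat.{u, u} ⟶ V}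
    (h : f.toFunctor.obj unitObj = g.toFunctor.obj unitObj) : f = g := by
  refine Cat.Hom.ext (CategoryTheory.Functor.ext (fun _ ↦ h) fun _ _ _ ↦ ?_)
  refine (f.toFunctor.map_id unitObj).trans (.trans ?_
    (congr_arg (eqToHom h ≫ · ≫ eqToHom h.symm) (g.toFunctor.map_id unitObj).symm))
  simp

lemma rightUnitor_inv_whiskerLeft {J : Cat.{u, u}} (i : 𝟙_ Cat.{u, u} ⟶ J) :
    (ρ_ J).inv ≫ J ◁ i = (Prod.sectL J (i.toFunctor.obj unitObj)).toCatHom := by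
  refine Cat.Hom.ext (Functor.hext (fun _ ↦ rfl) fun _ _ k ↦ ?_)
  exact heq_of_eq (Prod.ext rfl (i.toFunctor.map_id _))

lemma leftUnitor_inv_whiskerRight {J : Cat.{u, u}} (i : 𝟙_ Cat.{u, u} ⟶ J) :
    (λ_ J).inv ≫ i ▷ J = (Prod.sectR (i.toFunctor.obj unitObj) J).toCatHom := by
  refine Cat.Hom.ext (Functor.hext (fun _ ↦ rfl) fun _ _ k ↦ ?_)
  exact heq_of_eq (Prod.ext (i.toFunctor.map_id _) rfl)

/-! ### Consequences of a cartesian Thomason model structure -/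

variable [ModelCategory Cat.{u, u}]

lemma exists_extension (hW : weakEquivalences Cat.{u, u} = thomasonWeakEquivalences.{u})
    (hC : IsCartesianModelCategory Cat.{u, u}) {J : Cat.{u, u}} {i : 𝟙_ Cat.{u, u} ⟶ J}
    (hi : trivialCofibrations _ i) {V : Type u} [Category.{u} V] (p q : J ⥤ V)
    (h : p.obj (i.toFunctor.obj unitObj) = q.obj (i.toFunctor.obj unitObj)) :
    ∃ (V' : Type u) (_ : Category.{u} V') (P : V ⥤ V') (H : J × J ⥤ V'),
      thomasonWeakEquivalences P.toCatHom ∧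
      Prod.sectL J (i.toFunctor.obj unitObj) ⋙ H = p ⋙ P ∧
      Prod.sectR (i.toFunctor.obj unitObj) J ⋙ H = q ⋙ P := by
  have h' : i ≫ p.toCatHom = i ≫ q.toCatHom := unit_hom_ext h
  obtain ⟨V', P, H, hP, h₁, h₂⟩ :=
    IsMonoidalModelCategory.exists_extension (C := Cat.{u, u}) hC hi h'
  rw [← Category.assoc, rightUnitor_inv_whiskerLeft] at h₁
  rw [← Category.assoc, leftUnitor_inv_whiskerRight] at h₂
  refine ⟨V', inferInstance, P.toFunctor, H.toFunctor, ?_, ?_, ?_⟩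
  · have := (weakEquivalence_iff _).1 hP
    rwa [hW] at this
  · exact congr_arg (fun F : J ⟶ V' ↦ F.toFunctor) h₁
  · exact congr_arg (fun F : J ⟶ V' ↦ F.toFunctor) h₂

lemma hasVanishingSums (hW : weakEquivalences Cat.{u, u} = thomasonWeakEquivalences.{u})
    (hC : IsCartesianModelCategory Cat.{u, u}) {J : Cat.{u, u}} {i : 𝟙_ Cat.{u, u} ⟶ J}
    (hi : trivialCofibrations _ i) :
    HasVanishingSums (i.toFunctor.obj unitObj) := by
  intro V _ p q c hc h x f v s t s' t' hs ht hst hst'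
  obtain ⟨V', _, P, H, hP, h₁, h₂⟩ := exists_extension hW hC hi p q h
  obtain ⟨d, b, hd, hb⟩ := exists_catCocycle (F := P) hP hc
  obtain ⟨z, m, m', hm⟩ := exists_comp_eq H h₁ h₂ (congr_arg P.obj h) f
  exact hd.sum_eq_zero_of_cohomologous P hb h (z := z) hm hs ht hst hst'

/-- Functors `Jᵒᵖ ⥤ V` are regarded as functors `J ⥤ Vᵒᵖ`, so the extension is made for `J` itself
and the model structure is never dualized. -/
lemma hasVanishingSums_op (hW : weakEquivalences Cat.{u, u} = thomasonWeakEquivalences.{u})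
    (hC : IsCartesianModelCategory Cat.{u, u}) {J : Cat.{u, u}} {i : 𝟙_ Cat.{u, u} ⟶ J}
    (hi : trivialCofibrations _ i) :
    HasVanishingSums (Opposite.op (i.toFunctor.obj unitObj)) := by
  intro V _ p q c hc h x f v s t s' t' hs ht hst hst'
  obtain ⟨V', _, P, H, hP, h₁, h₂⟩ :=
    exists_extension hW hC hi p.rightOp q.rightOp (congr_arg Opposite.op h)
  obtain ⟨d, b, hd, hb⟩ := exists_catCocycle (F := P) hP hc.op
  obtain ⟨z, m, m', hm⟩ := exists_eq_comp H h₁ h₂ (congr_arg (fun x ↦ P.obj (.op x)) h.symm) f.unop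
  have hm' := congr_arg Quiver.Hom.op hm
  rw [op_comp, op_comp, eqToHom_op] at hm'
  exact hd.op.sum_eq_zero_of_cohomologous P.rightOp (b := fun _ _ f ↦ b f.op)
    (fun x y z f g ↦ (hb g.op f.op).trans (by rw [add_comm (b _)]; rfl)) h hm' hs ht hst hst'

/-- The terminal category may fail to be cofibrant. Its cofibrant replacement is still nonempty, and
the constant functor at `b` lifts from there. -/
lemma exists_obj_eq_of_trivialFibration
    (hW : weakEquivalences Cat.{u, u} = thomasonWeakEquivalences.{u}) {E B : Cat.{u, u}} (g : E ⟶ B)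
    [Fibration g] [WeakEquivalence g] (b : B) : ∃ e : E, g.toFunctor.obj e = b := by
  let h := MorphismProperty.factorizationData (cofibrations Cat.{u, u})
    (trivialFibrations Cat.{u, u})
    (Limits.initial.to (𝟙_ Cat.{u, u}))
  have hp : thomasonWeakEquivalences h.p := by
    rw [← hW]
    exact h.hp.2
  obtain ⟨x⟩ := nonempty_of_thomasonWeakEquivalence hp unitObj
  let f : h.Z ⟶ B := ((Functor.const h.Z).obj b).toCatHom
  have sq : CommSq (Limits.initial.to E) h.i g f := ⟨Limits.initial.hom_ext _ _⟩
  exact ⟨sq.lift.toFunctor.obj x, congr_arg (fun k : h.Z ⟶ B ↦ k.toFunctor.obj x) sq.fac_right⟩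

lemma hom_nonempty_iff (hW : weakEquivalences Cat.{u, u} = thomasonWeakEquivalences.{u})
    (hC : IsCartesianModelCategory Cat.{u, u}) {J : Cat.{u, u}} {i : 𝟙_ Cat.{u, u} ⟶ J}
    (hi : trivialCofibrations _ i) {x y : J} (k : x ⟶ y) :
    Nonempty (i.toFunctor.obj unitObj ⟶ x) ↔ Nonempty (i.toFunctor.obj unitObj ⟶ y) := by
  refine ⟨fun ⟨f⟩ ↦ ⟨f ≫ k⟩, fun ⟨f⟩ ↦ ?_⟩
  have := (hasVanishingSums hW hC hi).isSplitMono f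
  -- `k ≫ retraction f` is a morphism `x ⟶ o`, hence a split epi; its section is a morphism `o ⟶ x`.
  have := (hasVanishingSums_op hW hC hi).isSplitMono (k ≫ retraction f).op
  exact ⟨(retraction (k ≫ retraction f).op).unop⟩

lemma hom_nonempty (hW : weakEquivalences Cat.{u, u} = thomasonWeakEquivalences.{u})
    (hC : IsCartesianModelCategory Cat.{u, u}) {J : Cat.{u, u}} {i : 𝟙_ Cat.{u, u} ⟶ J}
    (hi : trivialCofibrations _ i) (x : J) : Nonempty (x ⟶ i.toFunctor.obj unitObj) := by
  have := hi.1
  have : WeakEquivalence i := ⟨hi.2⟩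
  let t : J ⟶ 𝟙_ Cat.{u, u} := CartesianMonoidalCategory.toUnit J
  have ht : WeakEquivalence t := weakEquivalence_of_precomp_of_fac
    (show i ≫ t = 𝟙 _ from CartesianMonoidalCategory.toUnit_unique _ _)
  replace ht : thomasonWeakEquivalences t := by
    rw [← hW]
    exact (weakEquivalence_iff _).1 ht
  -- Since `J` is weakly equivalent to the terminal category, an invariant predicate is constant;
  -- this one holds at `o` by the identity.
  obtain ⟨q, hq⟩ := exists_predicate ht (fun x ↦ Nonempty (i.toFunctor.obj unitObj ⟶ x))
    (fun _ _ k ↦ hom_nonempty_iff hW hC hi k)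
  obtain ⟨f⟩ := (hq x).2 ((hq (i.toFunctor.obj unitObj)).1 ⟨𝟙 _⟩)
  have := (hasVanishingSums hW hC hi).isSplitMono f
  exact ⟨retraction f⟩

end ThomasonCat

/-- A model structure on the category of small categories whose weak equivalences are the
Thomason weak equivalences is not cartesian. -/
theorem proposition4p3 [ModelCategory Cat.{u, u}]
    (hW : weakEquivalences Cat.{u, u} = ThomasonCat.thomasonWeakEquivalences.{u}) :
    ¬ ThomasonCat.IsCartesianModelCategory Cat.{u, u} := by
  intro hC
  let I := ULift.{u} (Fin 2)
  let z : 𝟙_ Cat.{u, u} ⟶ Cat.of I :=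
    Functor.toCatHom (C := (𝟙_ Cat.{u, u} : Cat.{u, u})) ((Functor.const _).obj (⊥ : I))
  let t : Cat.of I ⟶ 𝟙_ Cat.{u, u} := CartesianMonoidalCategory.toUnit _
  have ht : WeakEquivalence t := by
    rw [weakEquivalence_iff, hW]
    exact ThomasonCat.thomasonWeakEquivalences_of_orderBot I t
  have hz : WeakEquivalence z := weakEquivalence_of_postcomp_of_fac
    (show z ≫ t = 𝟙 _ from CartesianMonoidalCategory.toUnit_unique _ _)
  let h := MorphismProperty.factorizationData (trivialCofibrations Cat.{u, u})
    (fibrations Cat.{u, u}) z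
  have : WeakEquivalence h.p := weakEquivalence_of_precomp_of_fac h.fac
  obtain ⟨x, hx⟩ := ThomasonCat.exists_obj_eq_of_trivialFibration hW h.p (ULift.up 1 : I)
  obtain ⟨f⟩ := ThomasonCat.hom_nonempty hW hC h.hi x
  have h₀ : h.p.toFunctor.obj (h.i.toFunctor.obj ThomasonCat.unitObj) = (⊥ : I) :=
    congr_arg (fun k : 𝟙_ Cat.{u, u} ⟶ Cat.of I ↦ k.toFunctor.obj ThomasonCat.unitObj) h.fac
  have h₁ : (ULift.up 1 : I) ≤ ⊥ := hx ▸ h₀ ▸ leOfHom (h.p.toFunctor.map f)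
  exact absurd h₁ (by decide)
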